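/- **Theorem.** Let $n\in\mathbb Z$ and let $K_n=C(2n,4)$ be the two-bridge knot (the unknot for $n=0$) that has a diagram with two twist regions, of $2|n|$ and of $4$ crossings, in both of which the two strands run in opposite directions; the four crossings of the second region are positive, those of the first region are negative if $n>0$ (the diagram is then alternating) and positive if $n<0$. Let $\mu,\lambda\in\pi_1(S^3\setminus K_n)$ be a meridian and the null-homologous longitude commuting with it. Let $E_n\subset(\mathbb C^*)^2$ be the set of all pairs $(L,M)$ for which there is a representation $\rho:\pi_1(S^3\setminus K_n)\to \mathrm{SL}(2,\mathbb C)$ such that $\rho(\lambda)$, $\rho(\mu)$ are upper triangular with upper left entries $L$, $M$, and let $E_n^{\mathrm{na}}\subset E_n$ be the set of those pairs that come from some $\rho$ with non-abelian image. For $E\subset\mathbb C^2$ let $D(E)$ be the union of the one-dimensional irreducible components of the Zariski closure of $E$ in $\mathbb C^2$. We say that $A\in\mathbb Z[L,M]$ defines $D(E)$ up to repeated factors if the coefficients of $A$ are coprime and the irreducible factors of $A$ in $\mathbb C[L,M]$ are, up to constants, exactly the irreducible polynomials that define the components of $D(E)$. The polynomial that defines $D(E_n)$ is the $A$-polynomial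 of $K_n$ of Cooper–Culler–Gillet–Long–Shalen (including the factor $L-1$, which comes from the abelian representations); the one that defines $D(E_n^{\mathrm{na}})$ is the $A$-polynomial with the usual convention that this factor is omitted. For $n\ge 0$ put $$\begin{aligned}p_{2n}(z)=\sum_{i=0}^{2n}&\binom{\lfloor\frac i2\rfloor+n}{i}\,2^{-2\lfloor\frac{i+1}2\rfloor-i}\,(M^2)^{-\lfloor\frac i2\rfloor-2\lfloor\frac{i+1}2\rfloor+i+n}\,(LM^2+1)^{-2\lfloor\frac{i+1}2\rfloor-i+2n}\\&\times(-2LM^6+LM^4-LM^2-M^4+M^2z+M^2-2)^{\lfloor\frac{i+1}2\rfloor}\,(LM^2+L+M^2+z+1)^i\\&\times(-3LM^2+L+M^2+z-3)^{\lfloor\frac{i-1}2\rfloor}\,\bigl((-1)^{i+1}(LM^2+1)-2LM^2+L+M^2+z-2\bigr),\end{aligned}$$ and for $n<0$ put $$\begin{aligned}p_{2n}(z)=\sum_{i=0}^{-2n}&\binom{\lfloor\frac{i-1}2\rfloor-n}{i}\,2^{-2\lfloor\frac{i+1}2\rfloor-i}\,(M^2)^{-\lfloor\frac i2\rfloor-2\lfloor\frac{i+1}2\rfloor+i-n}\,(LM^2+1)^{-\frac12-2\lfloor\frac{i+1}2\rfloor-i-2n}\\&\times(-2LM^6+LM^4-LM^2-M^4+M^2z+M^2-2)^{\lfloor\frac{i+1}2\rfloor}\,(LM^2+L+M^2+z+1)^i\\&\times(-3LM^2+L+M^2+z-3)^{\lfloor\frac{i-1}2\rfloor}\,\bigl((-1)^{i}(-2LM^2+L+M^2+z-2)-LM^2-1\bigr).\end{aligned}$$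 Let $u=\sqrt{5L^2M^4-2L^2M^2+L^2-2LM^4+12LM^2-2L+M^4-2M^2+5}$; $u$ and $(LM^2+1)^{1/2}$ are taken in an algebraic closure of $\mathbb Q(L,M)$, with any choice of the roots (the same choice of $(LM^2+1)^{1/2}$ in both factors of the product below). Then $A_{2n}=p_{2n}(u)\,p_{2n}(-u)$ is a polynomial in $\mathbb Z[L,M]$ that does not depend on the choice of the roots. It is divisible by none of $L$, $M$, $LM^2+1$, $L-1$. Up to repeated factors, $A_{2n}$ defines $D(E_n^{\mathrm{na}})$ and $(L-1)A_{2n}$ defines $D(E_n)$; that is, $A_{2n}$ has exactly the irreducible factors of the $A$-polynomial of $C(2n,4)$, the factor $L-1$ of the abelian representations being omitted. -/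

import Mathlib

open MvPolynomial

noncomputable section

/-! ### Knot diagrams, knot groups, peripheral elements -/

/-- A signed Gauss code of an oriented knot diagram. Walking once along the knot from a base point one
meets the crossings at `2 * crossings` passes, numbered cyclically by `ZMod (2 * crossings)`. Crossing
`c` is met once on the upper strand, at the pass `overAt c`, and once on the lower strand, at the pass
`underAt c`; `sign c` is the usual sign of the crossing (`1` for a right-handed one). -/
structure SignedGaussCode where
  crossings : ℕ
  overAt : Fin crossings → ZMod (2 * crossings)
  underAt : Fin crossings → ZMod (2 * crossings)
  sign : Fin crossings → ℤˣ
  passes : Function.Bijective (Sum.elim overAt underAt)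

namespace SignedGaussCode

variable (D : SignedGaussCode)

/-- The Wirtinger relators. The generator `k` is the meridian of the edge that runs into the pass `k`,
so the edge that leaves the pass `k` is `k + 1`. At a crossing the upper strand keeps its meridian `y`,
and the meridian `x` of the lower strand becomes `y⁻¹ x y` at a positive and `y x y⁻¹` at a negative
crossing. -/
def wirtingerRels : Set (FreeGroup (ZMod (2 * D.crossings))) :=
  {r | ∃ c : Fin D.crossings,
    r = (FreeGroup.of (D.overAt c + 1))⁻¹ * FreeGroup.of (D.overAt c) ∨
    r = (FreeGroup.of (D.underAt c + 1))⁻¹ *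
      (FreeGroup.of (D.overAt c) ^ (-(D.sign c : ℤ)) * FreeGroup.of (D.underAt c) *
        FreeGroup.of (D.overAt c) ^ (D.sign c : ℤ))}

/-- The knot group, i.e. the fundamental group of the knot exterior, by its Wirtinger presentation. -/
abbrev knotGroup : Type := PresentedGroup D.wirtingerRels

/-- The meridian of the edge `k`. -/
def edgeMeridian (k : ZMod (2 * D.crossings)) : D.knotGroup := PresentedGroup.of k

/-- The meridian at the base point. -/
def meridian : D.knotGroup := D.edgeMeridian 0

/-- The contribution of the pass `k` to the blackboard longitude: nothing at an overpass; at an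
underpass, the meridian of the upper strand, to the power of the sign of the crossing. -/
def passFactor (k : ZMod (2 * D.crossings)) : D.knotGroup :=
  match (Equiv.ofBijective _ D.passes).symm k with
  | Sum.inl _ => 1
  | Sum.inr c => D.edgeMeridian (D.overAt c) ^ (D.sign c : ℤ)

def writhe : ℤ := ∑ c, (D.sign c : ℤ)

/-- The null-homologous longitude that commutes with `meridian`: the blackboard longitude, corrected
by a power of the meridian. -/
def longitude : D.knotGroup :=
  ((List.range (2 * D.crossings)).map fun k : ℕ => D.passFactor k).prod * D.meridian ^ (-D.writhe)

/-! ### The eigenvalue variety and the A-polynomial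

Points `v` of the plane `Fin 2 → ℂ` have the coordinates `L = v 0` and `M = v 1`. -/

/-- `v = (L, M)` is the pair of the upper left entries of `ρ(longitude)` and `ρ(meridian)`, both
of which are upper triangular. -/
def IsEigenvaluePair (ρ : D.knotGroup →* Matrix.SpecialLinearGroup (Fin 2) ℂ) (v : Fin 2 → ℂ) : Prop :=
  ρ D.longitude 1 0 = 0 ∧ ρ D.meridian 1 0 = 0 ∧ ρ D.longitude 0 0 = v 0 ∧ ρ D.meridian 0 0 = v 1

/-- The pairs `(L, M)` of all representations of the knot group in `SL(2, ℂ)`. -/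
def eigenvaluePairs : Set (Fin 2 → ℂ) :=
  {v | ∃ ρ : D.knotGroup →* Matrix.SpecialLinearGroup (Fin 2) ℂ, D.IsEigenvaluePair ρ v}

/-- The pairs `(L, M)` of the representations with non-abelian image. -/
def nonabelianEigenvaluePairs : Set (Fin 2 → ℂ) :=
  {v | ∃ ρ : D.knotGroup →* Matrix.SpecialLinearGroup (Fin 2) ℂ,
    (∃ g h, ρ g * ρ h ≠ ρ h * ρ g) ∧ D.IsEigenvaluePair ρ v}

end SignedGaussCode

/-- The irreducible polynomial `F` defines a one-dimensional irreducible component of the Zariski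
closure of `E` in `ℂ²`: the irreducible components of the closure correspond to the minimal primes
of the vanishing ideal of `E`, and the prime ideals of plane curves are the ideals `(F)`. -/
def IsCurveComponent (E : Set (Fin 2 → ℂ)) (F : MvPolynomial (Fin 2) ℂ) : Prop :=
  Irreducible F ∧ Ideal.span {F} ∈ (vanishingIdeal ℂ E).minimalPrimes

/-- Up to repeated factors, `A` is the defining polynomial, with coprime integer coefficients, of the
union of the one-dimensional irreducible components of the Zariski closure of `E`. -/
def DefinesCurvePart (E : Set (Fin 2 → ℂ)) (A : MvPolynomial (Fin 2) ℤ) : Prop :=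
  (∀ c : ℤ, C c ∣ A → IsUnit c) ∧
    ∀ F : MvPolynomial (Fin 2) ℂ, Irreducible F →
      (F ∣ map (Int.castRingHom ℂ) A ↔ IsCurveComponent E F)

/-! ### The knot `C(2n, 4)`

The diagram has two twist regions: one with the `2|n|` crossings `0, …, 2|n| - 1` and one with the
four crossings `2|n|, …, 2|n| + 3`. In both of them the two strands run in opposite directions. The
knot runs through the first region forwards, through the second one forwards, through the first one
backwards and through the second one backwards. Within each region the strand that comes first
passes over and under alternately. For `n > 0` the diagram is alternating, for `n < 0` the crossings
of the first region are switched. -/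

namespace ConwayKnot

/-- The number of crossings in the first twist region. -/
def k (n : ℤ) : ℕ := 2 * n.natAbs

/-- The crossings are numbered in the order in which they are first met. -/
def firstPass (n : ℤ) (c : Fin (k n + 4)) : ℕ := c

def secondPass (n : ℤ) (c : Fin (k n + 4)) : ℕ :=
  if (c : ℕ) < k n then 2 * k n + 3 - c else 3 * k n + 7 - c

/-- The crossing `c` is first met on the upper strand. -/
def FirstIsOver (n : ℤ) (c : Fin (k n + 4)) : Prop :=
  if (c : ℕ) < k n then (Even (c : ℕ) ↔ 0 < n) else Even (c : ℕ)

open Classical in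
def overPass (n : ℤ) (c : Fin (k n + 4)) : ℕ :=
  if FirstIsOver n c then firstPass n c else secondPass n c

open Classical in
def underPass (n : ℤ) (c : Fin (k n + 4)) : ℕ :=
  if FirstIsOver n c then secondPass n c else firstPass n c

theorem pass_inj (n : ℤ) : Function.Injective
    (Sum.elim (fun c => (overPass n c : ZMod (2 * (k n + 4))))
      (fun c => (underPass n c : ZMod (2 * (k n + 4))))) := by
  have hcast : ∀ a b : ℕ, a < 2 * (k n + 4) → b < 2 * (k n + 4) →
      (a : ZMod (2 * (k n + 4))) = b → a = b := by
    intro a b ha hb h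
    rw [ZMod.natCast_eq_natCast_iff] at h
    exact Nat.ModEq.eq_of_lt_of_lt h ha hb
  have ho : ∀ c, overPass n c < 2 * (k n + 4) := by
    intro c; have := c.2
    unfold overPass firstPass secondPass; split_ifs <;> omega
  have hu : ∀ c, underPass n c < 2 * (k n + 4) := by
    intro c; have := c.2
    unfold underPass firstPass secondPass; split_ifs <;> omega
  rintro (c | c) (d | d) h <;> have hc := c.2 <;> have hd := d.2
  · have := hcast _ _ (ho c) (ho d) h
    congr 1; ext
    unfold overPass firstPass secondPass at this; split_ifs at this <;> omega
  · exfalso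
    have h' := hcast _ _ (ho c) (hu d) h
    by_cases e : c = d
    · subst e
      unfold overPass underPass firstPass secondPass at h'; split_ifs at h' <;> omega
    · have e' : (c : ℕ) ≠ d := fun q => e (Fin.ext q)
      unfold overPass underPass firstPass secondPass at h'; split_ifs at h' <;> omega
  · exfalso
    have h' := hcast _ _ (hu c) (ho d) h
    by_cases e : c = d
    · subst e
      unfold overPass underPass firstPass secondPass at h'; split_ifs at h' <;> omega
    · have e' : (c : ℕ) ≠ d := fun q => e (Fin.ext q)
      unfold overPass underPass firstPass secondPass at h'; split_ifs at h' <;> omega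
  · have := hcast _ _ (hu c) (hu d) h
    congr 1; ext
    unfold underPass firstPass secondPass at this; split_ifs at this <;> omega

/-- The knot with Conway's notation `C(2n, 4)`. -/
def knot (n : ℤ) : SignedGaussCode where
  crossings := k n + 4
  overAt c := overPass n c
  underAt c := underPass n c
  sign c := if (c : ℕ) < k n ∧ 0 < n then -1 else 1
  passes := by
    rw [Fintype.bijective_iff_injective_and_card]
    refine ⟨pass_inj n, ?_⟩
    simp [ZMod.card]
    omega

end ConwayKnot

/-! ### The explicit formula -/

/-- `p_{2n}(z)`, over a field with elements `L`, `M` and a square root `r` of `L M² + 1`, so that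
`(L M² + 1) ^ (-1/2 + e)` is `r ^ (-1 + 2e)`. Division of integers rounds down. -/
def pFormula {K : Type*} [Field K] (n : ℤ) (L M r z : K) : K :=
  if 0 ≤ n then
    ∑ i ∈ Finset.range ((2 * n).toNat + 1),
      ((Ring.choose ((i : ℤ) / 2 + n) i : ℤ) : K)
      * 2 ^ (-2 * (((i : ℤ) + 1) / 2) - i)
      * (M ^ 2) ^ (-((i : ℤ) / 2) - 2 * (((i : ℤ) + 1) / 2) + i + n)
      * (L * M ^ 2 + 1) ^ (-2 * (((i : ℤ) + 1) / 2) - i + 2 * n)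
      * (-2 * L * M ^ 6 + L * M ^ 4 - L * M ^ 2 - M ^ 4 + M ^ 2 * z + M ^ 2 - 2)
          ^ (((i : ℤ) + 1) / 2)
      * (L * M ^ 2 + L + M ^ 2 + z + 1) ^ i
      * (-3 * L * M ^ 2 + L + M ^ 2 + z - 3) ^ (((i : ℤ) - 1) / 2)
      * ((-1) ^ (i + 1) * (L * M ^ 2 + 1) - 2 * L * M ^ 2 + L + M ^ 2 + z - 2)
  else
    ∑ i ∈ Finset.range ((-2 * n).toNat + 1),
      ((Ring.choose (((i : ℤ) - 1) / 2 - n) i : ℤ) : K)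
      * 2 ^ (-2 * (((i : ℤ) + 1) / 2) - i)
      * (M ^ 2) ^ (-((i : ℤ) / 2) - 2 * (((i : ℤ) + 1) / 2) + i - n)
      * r ^ (-1 + 2 * (-2 * (((i : ℤ) + 1) / 2) - i - 2 * n))
      * (-2 * L * M ^ 6 + L * M ^ 4 - L * M ^ 2 - M ^ 4 + M ^ 2 * z + M ^ 2 - 2)
          ^ (((i : ℤ) + 1) / 2)
      * (L * M ^ 2 + L + M ^ 2 + z + 1) ^ i
      * (-3 * L * M ^ 2 + L + M ^ 2 + z - 3) ^ (((i : ℤ) - 1) / 2)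
      * ((-1) ^ i * (-2 * L * M ^ 2 + L + M ^ 2 + z - 2) - L * M ^ 2 - 1)

/-- The radicand: `u` is a square root of it. -/
def uSquared {K : Type*} [Field K] (L M : K) : K :=
  5 * L ^ 2 * M ^ 4 - 2 * L ^ 2 * M ^ 2 + L ^ 2 - 2 * L * M ^ 4 + 12 * L * M ^ 2 - 2 * L
    + M ^ 4 - 2 * M ^ 2 + 5

/-- The ring `ℤ[L, M]`, with `L = X 0` and `M = X 1`. -/
abbrev PolyLM : Type := MvPolynomial (Fin 2) ℤ

/-- An algebraic closure of the field of fractions of `ℤ[L, M]`, in which the square roots live. -/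
abbrev AlgFun : Type := AlgebraicClosure (FractionRing PolyLM)

/-- `L` and `M` as algebraic functions. -/
def Lfun : AlgFun := algebraMap PolyLM AlgFun (X 0)

def Mfun : AlgFun := algebraMap PolyLM AlgFun (X 1)

end

/-! Following a coloring of the diagram through the two twist regions expresses all Wirtinger
generators by two of them, `a` and `c`, and leaves one relation `c * r ^ n = r ^ n * a`, where
`r = a⁻¹ * s ^ 2 * a * s⁻²` and `s = c * a⁻¹`; the longitude becomes the commutator of `r⁻ⁿ` and
`s⁻²`. For noncommuting `a` and `c` in `SL(2)`, with `a` diagonal with entries `M ≠ M⁻¹`, the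
relation is one equation in `M ^ 2` and `y = tr s`, the vanishing of the Riley polynomial, and the
upper left entry `L` of the longitude satisfies
`(L * M ^ 2 + 1) * y ^ 2 - (L + 1) * (M ^ 2 + 1) * y - (L - 1) * (M ^ 2 - 1) = 0`.

The resultant with respect to `y` of the Riley polynomial, of degree `d`, and this quadratic is
`(L * M ^ 2 + 1) ^ d` times the product of the values of the Riley polynomial at the two roots. The
discriminant of the quadratic is `u ^ 2`, so these roots correspond to `z = u` and `z = -u`, and
expanding the Chebyshev polynomials in the Riley polynomial at the argument `2` turns its values,
times `(L * M ^ 2 + 1) ^ (d / 2)`, into the sums `p_{2n}(± u)`. Hence `A_{2n}` is this resultant.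

Conversely, a zero of the resultant off the curves `M = 0`, `M ^ 4 = 1` and `L * M ^ 2 + 1 = 0`
comes from a common root `y`, hence from a nonabelian representation; none of these curves is a
component of `A_{2n} = 0`, because each carries a point where the resultant does not vanish. The
representations with `M ^ 2 = 1` add only isolated points, with `L ^ 2 = 1`.
-/

noncomputable section

section ChebyshevS

open Polynomial.Chebyshev (S)

variable {R : Type*} [CommRing R]

theorem sum_choose_succ_odd (t : R) (n : ℕ) :
    ∑ j ∈ Finset.range (n + 2), ((n + 2 + j).choose (2 * j + 1) : R) * t ^ j =
      ∑ j ∈ Finset.range (n + 1), ((n + 1 + j).choose (2 * j + 1) : R) * t ^ j +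
        ∑ j ∈ Finset.range (n + 2), ((n + 1 + j).choose (2 * j) : R) * t ^ j := by
  have extend : ∑ j ∈ Finset.range (n + 1), ((n + 1 + j).choose (2 * j + 1) : R) * t ^ j =
      ∑ j ∈ Finset.range (n + 2), ((n + 1 + j).choose (2 * j + 1) : R) * t ^ j := by
    rw [Finset.sum_range_succ _ (n + 1), Nat.choose_eq_zero_of_lt (by lia)]
    simp
  rw [extend, ← Finset.sum_add_distrib]
  refine Finset.sum_congr rfl fun j _ ↦ ?_
  rw [show n + 2 + j = n + 1 + j + 1 by ring, Nat.choose_succ_succ]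
  push_cast
  ring

theorem sum_choose_succ_even (t : R) (n : ℕ) :
    ∑ j ∈ Finset.range (n + 2), ((n + 1 + j).choose (2 * j) : R) * t ^ j =
      ∑ j ∈ Finset.range (n + 1), ((n + j).choose (2 * j) : R) * t ^ j +
        t * ∑ j ∈ Finset.range (n + 1), ((n + 1 + j).choose (2 * j + 1) : R) * t ^ j := by
  have extend : ∑ j ∈ Finset.range (n + 1), ((n + j).choose (2 * j) : R) * t ^ j =
      ∑ j ∈ Finset.range (n + 2), ((n + j).choose (2 * j) : R) * t ^ j := by
    rw [Finset.sum_range_succ _ (n + 1), Nat.choose_eq_zero_of_lt (by lia)]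
    simp
  rw [extend, Finset.sum_range_succ' _ (n + 1), Finset.sum_range_succ' _ (n + 1), Finset.mul_sum]
  simp only [mul_zero, Nat.choose_zero_right]
  rw [add_right_comm, ← Finset.sum_add_distrib]
  congr 1
  refine Finset.sum_congr rfl fun j _ ↦ ?_
  rw [show n + 1 + (j + 1) = n + 1 + j + 1 by ring, show 2 * (j + 1) = 2 * j + 1 + 1 by ring,
    Nat.choose_succ_succ, show n + (j + 1) = n + 1 + j by ring]
  push_cast
  ring

theorem eval_chebyshevS_add_one (x : R) (n : ℤ) :
    (S R (n + 1)).eval x = x * (S R n).eval x - (S R (n - 1)).eval x := by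
  simp [Polynomial.Chebyshev.S_add_one]

theorem eval_chebyshevS_two_add_eq_sum (t : R) (n : ℕ) :
    (S R n).eval (2 + t) =
        ∑ j ∈ Finset.range (n + 1), ((n + 1 + j).choose (2 * j + 1) : R) * t ^ j ∧
      (S R n).eval (2 + t) - (S R (n - 1)).eval (2 + t) =
        ∑ j ∈ Finset.range (n + 1), ((n + j).choose (2 * j) : R) * t ^ j := by
  induction n with
  | zero => simp
  | succ n ih =>
    obtain ⟨hS, hdiff⟩ := ih
    have hrec := eval_chebyshevS_add_one (2 + t) n
    rw [sum_choose_succ_odd, sum_choose_succ_even, ← hS, ← hdiff]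
    push_cast
    rw [add_sub_cancel_right, hrec]
    constructor <;> ring

theorem eval_chebyshevS_sub_one_two_add (t : R) (n : ℕ) : (S R (n - 1)).eval (2 + t) =
    ∑ j ∈ Finset.range n, ((n + j).choose (2 * j + 1) : R) * t ^ j := by
  rcases n with _ | n
  · simp
  · simpa using (eval_chebyshevS_two_add_eq_sum t n).1

theorem chebyshevS_negSucc (n : ℕ) : S R (Int.negSucc n) = -S R (n - 1) := by
  rw [Int.negSucc_eq, neg_add', Polynomial.Chebyshev.S_neg_sub_one]

theorem chebyshevS_negSucc_sub_one (n : ℕ) : S R (Int.negSucc n - 1) = -S R n := by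
  rw [← Polynomial.Chebyshev.S_neg_sub_two, Int.negSucc_eq]
  congr 1
  ring

/-- The homogenized Chebyshev polynomials of the second kind: `m ^ n * S n (2 + κ / m)` with a
shift of the index by one, written so that `m` need not be invertible. -/
def homChebyshevS (m κ : R) : ℕ → R
  | 0 => 0
  | 1 => 1
  | n + 2 => (2 * m + κ) * homChebyshevS m κ (n + 1) - m ^ 2 * homChebyshevS m κ n

@[simp] theorem homChebyshevS_zero (m κ : R) : homChebyshevS m κ 0 = 0 := by
  rw [homChebyshevS]

@[simp] theorem homChebyshevS_one (m κ : R) : homChebyshevS m κ 1 = 1 := by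
  rw [homChebyshevS]

theorem homChebyshevS_add_two (m κ : R) (n : ℕ) : homChebyshevS m κ (n + 2) =
    (2 * m + κ) * homChebyshevS m κ (n + 1) - m ^ 2 * homChebyshevS m κ n := by
  rw [homChebyshevS]

theorem map_homChebyshevS {A : Type*} [CommRing A] (f : R →+* A) (m κ : R) (n : ℕ) :
    f (homChebyshevS m κ n) = homChebyshevS (f m) (f κ) n := by
  induction n using Nat.twoStepInduction with
  | zero | one => simp
  | more n ih ih' => simp [homChebyshevS_add_two, ih, ih', map_ofNat f 2]

theorem homChebyshevS_mul_succ (m t : R) (n : ℕ) :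
    homChebyshevS m (m * t) (n + 1) = m ^ n * (S R n).eval (2 + t) := by
  induction n using Nat.twoStepInduction with
  | zero => simp
  | one => simp [homChebyshevS_add_two]; ring
  | more n ih ih' =>
    rw [homChebyshevS_add_two, ih, ih']
    push_cast
    rw [Polynomial.Chebyshev.S_add_two]
    simp only [Polynomial.eval_sub, Polynomial.eval_mul, Polynomial.eval_X]
    ring

theorem mul_homChebyshevS_mul (m t : R) (n : ℕ) :
    m * homChebyshevS m (m * t) n = m ^ n * (S R (n - 1)).eval (2 + t) := by
  cases n with
  | zero => simp
  | succ n => rw [homChebyshevS_mul_succ]; simp; ring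

theorem homChebyshevS_zero_right (m : R) (n : ℕ) :
    homChebyshevS m 0 (n + 1) = (n + 1) * m ^ n := by
  simpa [mul_comm] using homChebyshevS_mul_succ m 0 n

theorem mul_homChebyshevS_zero_right (m : R) (n : ℕ) : m * homChebyshevS m 0 n = n * m ^ n := by
  simpa [mul_comm] using mul_homChebyshevS_mul m 0 n

theorem homChebyshevS_zero_left (κ : R) (n : ℕ) : homChebyshevS 0 κ (n + 1) = κ ^ n := by
  induction n with
  | zero => simp
  | succ n ih => simp [homChebyshevS_add_two, ih, pow_succ']

theorem homChebyshevS_neg_one_four (n : ℕ) : homChebyshevS (-1 : R) 4 n = n := by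
  induction n using Nat.twoStepInduction with
  | zero | one => simp
  | more n ih ih' =>
    rw [homChebyshevS_add_two, ih, ih']
    push_cast
    ring

section Degree

variable (m : R) {κ : Polynomial R} {d : ℕ}

theorem natDegree_two_mul_C_add_le (hκ : κ.natDegree ≤ d) :
    (2 * Polynomial.C m + κ).natDegree ≤ d :=
  Polynomial.natDegree_add_le_of_degree_le (by compute_degree!) hκ

theorem natDegree_homChebyshevS_le (hκ : κ.natDegree ≤ d) (n : ℕ) :
    (homChebyshevS (Polynomial.C m) κ (n + 1)).natDegree ≤ d * n := by
  induction n using Nat.twoStepInduction with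
  | zero => simp
  | one => simpa [homChebyshevS_add_two] using natDegree_two_mul_C_add_le m hκ
  | more n ih ih' =>
    rw [homChebyshevS_add_two, ← map_pow]
    refine (Polynomial.natDegree_sub_le _ _).trans (max_le ?_ ?_)
    · exact (Polynomial.natDegree_mul_le_of_le (natDegree_two_mul_C_add_le m hκ) ih').trans
        (by lia)
    · exact (Polynomial.natDegree_C_mul_le _ _).trans (ih.trans (by lia))

theorem coeff_homChebyshevS (hd : 0 < d) (hκ : κ.natDegree ≤ d) (n : ℕ) :
    (homChebyshevS (Polynomial.C m) κ (n + 1)).coeff (d * n) = κ.coeff d ^ n := by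
  have hlead : (2 * Polynomial.C m + κ).coeff d = κ.coeff d := by
    rw [Polynomial.coeff_add, Polynomial.coeff_eq_zero_of_natDegree_lt, zero_add]
    exact (show (2 * Polynomial.C m).natDegree ≤ 0 by compute_degree!).trans_lt hd
  induction n using Nat.twoStepInduction with
  | zero => simp
  | one => simp [homChebyshevS_add_two, hlead]
  | more n _ ih' =>
    have hlow : (Polynomial.C (m ^ 2) * homChebyshevS (Polynomial.C m) κ (n + 1)).natDegree <
        d * (n + 2) :=
      (Polynomial.natDegree_C_mul_le _ _).trans_lt
        ((natDegree_homChebyshevS_le m hκ n).trans_lt (by gcongr; lia))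
    rw [homChebyshevS_add_two, ← map_pow, Polynomial.coeff_sub,
      Polynomial.coeff_eq_zero_of_natDegree_lt hlow, sub_zero,
      show d * (n + 2) = d + d * (n + 1) by ring, Polynomial.coeff_mul_add_eq_of_natDegree_le
        (natDegree_two_mul_C_add_le m hκ) (natDegree_homChebyshevS_le m hκ (n + 1)), hlead, ih']
    ring

end Degree

end ChebyshevS

namespace ConwayKnot

section Riley

open Polynomial.Chebyshev (S)

variable {R A : Type*} [CommRing R] [CommRing A]

/-- With `m = M ^ 2`, this is `m` times the difference between the trace `y` of the product of a
meridian and an inverse meridian and the value `M ^ 2 + M⁻²` of this trace at the reducible pairs of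
meridians with different diagonals. -/
def traceGap (m y : R) : R := m * y - m ^ 2 - 1

/-- The trace of the word `twistR` below, minus `2`, times `m = M ^ 2`. -/
def twistTrace (m y : R) : R := traceGap m y * y ^ 2 * (y - 2)

/-- The coefficient with which the leading Chebyshev polynomial is modified in `riley`. -/
def rileyFactor (m y : R) : R := traceGap m y * y * (y - 1) - m

/-- The Riley polynomial of `C(2n, 4)` times `m ^ |n|`, where `m = M ^ 2`, as a function of the
trace `y` of the product of a meridian and an inverse meridian. -/
def riley (n : ℤ) (m y : R) : R :=
  match n with
  | .ofNat n => homChebyshevS m (twistTrace m y) (n + 1) +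
      rileyFactor m y * homChebyshevS m (twistTrace m y) n
  | .negSucc n => -(rileyFactor m y * homChebyshevS m (twistTrace m y) (n + 1) +
      m ^ 2 * homChebyshevS m (twistTrace m y) n)

theorem riley_eq_chebyshevS (n : ℤ) {m y e τ : R} (he : traceGap m y = m * e)
    (hτ : τ = 2 + e * y ^ 2 * (y - 2)) :
    riley n m y =
      m ^ n.natAbs * ((S R n).eval τ + (e * y * (y - 1) - 1) * (S R (n - 1)).eval τ) := by
  have hκ : twistTrace m y = m * (e * y ^ 2 * (y - 2)) := by rw [twistTrace, he]; ring
  subst hτ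
  rcases n with n | n
  · have hn := mul_homChebyshevS_mul m (e * y ^ 2 * (y - 2)) n
    simp only [riley, rileyFactor, hκ, he, homChebyshevS_mul_succ, Int.ofNat_eq_natCast,
      Int.natAbs_natCast]
    linear_combination (e * y * (y - 1) - 1) * hn
  · have hn := mul_homChebyshevS_mul m (e * y ^ 2 * (y - 2)) n
    simp only [riley, rileyFactor, hκ, he, homChebyshevS_mul_succ, Int.natAbs_negSucc,
      Nat.succ_eq_add_one, chebyshevS_negSucc, chebyshevS_negSucc_sub_one, Polynomial.eval_neg]
    linear_combination -m * hn

theorem map_traceGap (f : R →+* A) (m y : R) : f (traceGap m y) = traceGap (f m) (f y) := by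
  simp [traceGap]

theorem map_riley (f : R →+* A) (n : ℤ) (m y : R) : f (riley n m y) = riley n (f m) (f y) := by
  rcases n with n | n <;>
    simp [riley, rileyFactor, twistTrace, map_homChebyshevS, map_traceGap, map_ofNat f 2]

theorem riley_of_twistTrace_eq_zero (n : ℤ) {m y : R} (hκ : twistTrace m y = 0)
    (hg : rileyFactor m y = -m) : riley n m y = m ^ n.natAbs := by
  rcases n with n | n <;> simp only [riley, hκ, hg, homChebyshevS_zero_right,
    Int.ofNat_eq_natCast, Int.natAbs_natCast, Int.natAbs_negSucc, Nat.succ_eq_add_one]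
  · linear_combination -mul_homChebyshevS_zero_right m n
  · linear_combination -m * mul_homChebyshevS_zero_right m n

theorem riley_zero_right (n : ℤ) (m : R) : riley n m 0 = m ^ n.natAbs :=
  riley_of_twistTrace_eq_zero n (by simp [twistTrace]) (by simp [rileyFactor])

theorem riley_one_two (n : ℤ) : riley n (1 : R) 2 = 1 := by
  rw [riley_of_twistTrace_eq_zero n (by simp [twistTrace])
    (by unfold rileyFactor traceGap; ring), one_pow]

theorem riley_neg_one (n : ℤ) {y : R} (hy : y ^ 2 = 2) : riley n (-1) y = 1 := by
  have hκ : twistTrace (-1) y = 4 := by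
    unfold twistTrace traceGap; linear_combination (-y ^ 2 + 2) * hy
  have hg : rileyFactor (-1) y = -1 := by
    unfold rileyFactor traceGap; linear_combination (-y - 1) * hy
  rcases n with n | n <;>
  · simp only [riley, hκ, hg, homChebyshevS_neg_one_four]
    push_cast
    ring

theorem riley_zero_left_ne_zero [IsDomain R] (n : ℤ) {y : R} (h0 : y ≠ 0) (h1 : y - 1 ≠ 0)
    (h2 : y - 2 ≠ 0) (h3 : y ^ 2 - y - 1 ≠ 0) : riley n 0 y ≠ 0 := by
  rcases n with (_ | n) | n
  · simp [riley]
  · have : riley (Int.ofNat (n + 1)) 0 y = twistTrace 0 y ^ n * (-y * (y ^ 2 - y - 1)) := by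
      simp only [riley, homChebyshevS_zero_left, pow_succ]
      simp only [traceGap, twistTrace, rileyFactor]
      ring
    rw [this]
    simp [twistTrace, traceGap, h0, h2, h3]
  · simp [riley, homChebyshevS_zero_left, twistTrace, rileyFactor, traceGap, h0, h1, h2]

/-- The degree of the Riley polynomial in `y`. -/
def rileyDegree : ℤ → ℕ
  | .ofNat n => 4 * n
  | .negSucc n => 4 * n + 3

/-- The Riley polynomial as a polynomial in `y`. -/
def rileyPoly (n : ℤ) (m : R) : Polynomial R := riley n (Polynomial.C m) Polynomial.X

theorem eval_rileyPoly (n : ℤ) (m y : R) : (rileyPoly n m).eval y = riley n m y := by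
  simpa [rileyPoly] using map_riley (Polynomial.evalRingHom y) n (Polynomial.C m) Polynomial.X

theorem map_rileyPoly (f : R →+* A) (n : ℤ) (m : R) :
    (rileyPoly n m).map f = rileyPoly n (f m) := by
  simpa [rileyPoly] using map_riley (Polynomial.mapRingHom f) n (Polynomial.C m) Polynomial.X

theorem natDegree_twistTrace_le (m : R) :
    (twistTrace (Polynomial.C m) Polynomial.X).natDegree ≤ 4 := by
  unfold twistTrace traceGap; compute_degree

theorem coeff_twistTrace (m : R) : (twistTrace (Polynomial.C m) Polynomial.X).coeff 4 = m := by
  unfold twistTrace traceGap; compute_degree!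

theorem natDegree_rileyFactor_le (m : R) :
    (rileyFactor (Polynomial.C m) Polynomial.X).natDegree ≤ 3 := by
  unfold rileyFactor traceGap; compute_degree

theorem coeff_rileyFactor (m : R) :
    (rileyFactor (Polynomial.C m) Polynomial.X).coeff 3 = m := by
  unfold rileyFactor traceGap; compute_degree!

theorem natDegree_C_sq_mul_homChebyshevS_le (m : R) (n : ℕ) :
    (Polynomial.C m ^ 2 * homChebyshevS (Polynomial.C m)
      (twistTrace (Polynomial.C m) Polynomial.X) n).natDegree ≤ 4 * n := by
  rw [← map_pow]
  refine (Polynomial.natDegree_C_mul_le _ _).trans ?_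
  rcases n with _ | n
  · simp
  · exact (natDegree_homChebyshevS_le m (natDegree_twistTrace_le m) n).trans (by lia)

theorem natDegree_rileyPoly_le (n : ℤ) (m : R) : (rileyPoly n m).natDegree ≤ rileyDegree n := by
  have hS := natDegree_homChebyshevS_le m (natDegree_twistTrace_le m)
  have hfactor := natDegree_rileyFactor_le m
  rcases n with (_ | n) | n
  · simp [rileyPoly, riley]
  · refine Polynomial.natDegree_add_le_of_degree_le (hS (n + 1)) ?_
    exact (Polynomial.natDegree_mul_le_of_le hfactor (hS n)).trans
      (by simp only [rileyDegree]; lia)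
  · refine Polynomial.natDegree_neg_le_of_le (Polynomial.natDegree_add_le_of_degree_le ?_ ?_)
    · exact (Polynomial.natDegree_mul_le_of_le hfactor (hS n)).trans
        (by simp only [rileyDegree]; lia)
    · exact (natDegree_C_sq_mul_homChebyshevS_le m n).trans (Nat.le_add_right _ 3)

theorem coeff_rileyPoly_eq_or_eq_neg (n : ℤ) (m : R) :
    (rileyPoly n m).coeff (rileyDegree n) = m ^ n.natAbs ∨
      (rileyPoly n m).coeff (rileyDegree n) = -m ^ n.natAbs := by
  have hS := natDegree_homChebyshevS_le m (natDegree_twistTrace_le m)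
  have hcoeff := coeff_homChebyshevS m four_pos (natDegree_twistTrace_le m)
  have hfactor := natDegree_rileyFactor_le m
  rcases n with (_ | n) | n
  · simp [rileyPoly, riley, rileyDegree]
  · left
    have hlow := (Polynomial.natDegree_mul_le_of_le hfactor (hS n)).trans_lt
      (show 3 + 4 * n < 4 * (n + 1) by lia)
    simp only [rileyPoly, riley, rileyDegree, Polynomial.coeff_add, hcoeff, coeff_twistTrace,
      Polynomial.coeff_eq_zero_of_natDegree_lt hlow, add_zero, Int.ofNat_eq_natCast,
      Int.natAbs_natCast]
  · right
    have hlow := (natDegree_C_sq_mul_homChebyshevS_le m n).trans_lt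
      (show 4 * n < 4 * n + 3 by lia)
    simp only [rileyPoly, riley, rileyDegree, Polynomial.coeff_neg, Polynomial.coeff_add,
      Polynomial.coeff_eq_zero_of_natDegree_lt hlow, add_zero]
    rw [add_comm (4 * n), Polynomial.coeff_mul_add_eq_of_natDegree_le hfactor (hS n),
      coeff_rileyFactor, hcoeff, coeff_twistTrace, Int.natAbs_negSucc, Nat.succ_eq_add_one,
      pow_succ']

end Riley

end ConwayKnot

section Resultant

variable {R : Type*} [CommRing R]

theorem resultant_C_mul_X_sub_C_mul_X_sub_C [Nontrivial R] {p : Polynomial R} {d : ℕ}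
    (hp : p.natDegree ≤ d) (a x y : R) :
    p.resultant (Polynomial.C a * ((Polynomial.X - Polynomial.C x) *
      (Polynomial.X - Polynomial.C y))) d 2 = a ^ d * (p.eval x * p.eval y) := by
  have hmul := Polynomial.resultant_mul_right p (Polynomial.X - Polynomial.C x)
    (Polynomial.X - Polynomial.C y) d hp
  rw [Polynomial.natDegree_X_sub_C, Polynomial.natDegree_X_sub_C,
    Polynomial.resultant_X_sub_C_right _ _ _ hp,
    Polynomial.resultant_X_sub_C_right _ _ _ hp] at hmul
  have hsign : (-1 : R) ^ d * (-1) ^ d = 1 := by rw [← mul_pow]; simp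
  rw [Polynomial.resultant_C_mul_right, hmul]
  linear_combination a ^ d * p.eval x * p.eval y * hsign

theorem resultant_C_mul_X_sub_C {p : Polynomial R} {d : ℕ} (hp : p.natDegree ≤ d) (a x : R) :
    p.resultant (Polynomial.C a * (Polynomial.X - Polynomial.C x)) d 2 =
      a ^ d * (p.coeff d * ((-1) ^ d * p.eval x)) := by
  rw [Polynomial.resultant_C_mul_right, show (2 : ℕ) = 1 + 1 from rfl,
    Polynomial.resultant_add_right_deg p _ d 1 1 (Polynomial.natDegree_X_sub_C_le _),
    Polynomial.resultant_X_sub_C_right _ _ _ hp, pow_one]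

end Resultant

namespace ConwayKnot

section Eliminant

variable {R A : Type*} [CommRing R] [CommRing A]

/-- The quadratic equation for the trace `y` in terms of the eigenvalues `L` and `M`, with
`m = M ^ 2`. -/
def traceQuadratic (L m : R) : Polynomial R :=
  Polynomial.C (L * m + 1) * Polynomial.X ^ 2 - Polynomial.C ((L + 1) * (m + 1)) * Polynomial.X
    - Polynomial.C ((L - 1) * (m - 1))

theorem natDegree_traceQuadratic_le (L m : R) : (traceQuadratic L m).natDegree ≤ 2 := by
  unfold traceQuadratic; compute_degree

theorem eval_traceQuadratic (L m y : R) : (traceQuadratic L m).eval y =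
    (L * m + 1) * y ^ 2 - (L + 1) * (m + 1) * y - (L - 1) * (m - 1) := by
  simp [traceQuadratic]

/-- The polynomial in `L` and `m = M ^ 2` that results from the elimination of `y` from the Riley
polynomial and `traceQuadratic`. -/
def eliminant (n : ℤ) (L m : R) : R :=
  (rileyPoly n m).resultant (traceQuadratic L m) (rileyDegree n) 2

theorem map_eliminant (f : R →+* A) (n : ℤ) (L m : R) :
    f (eliminant n L m) = eliminant n (f L) (f m) := by
  have : (traceQuadratic L m).map f = traceQuadratic (f L) (f m) := by simp [traceQuadratic]
  rw [eliminant, eliminant, ← Polynomial.resultant_map_map, map_rileyPoly, this]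

theorem eliminant_eq_mul [Nontrivial R] (n : ℤ) {L m y₁ y₂ : R}
    (hadd : (L * m + 1) * (y₁ + y₂) = (L + 1) * (m + 1))
    (hmul : (L * m + 1) * (y₁ * y₂) = -((L - 1) * (m - 1))) :
    eliminant n L m = (L * m + 1) ^ rileyDegree n * (riley n m y₁ * riley n m y₂) := by
  have hfactor : traceQuadratic L m = Polynomial.C (L * m + 1) *
      ((Polynomial.X - Polynomial.C y₁) * (Polynomial.X - Polynomial.C y₂)) := by
    have hadd' := congrArg Polynomial.C hadd
    have hmul' := congrArg Polynomial.C hmul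
    simp only [traceQuadratic, map_mul, map_add, map_neg] at hadd' hmul' ⊢
    linear_combination Polynomial.X * hadd' - hmul'
  rw [eliminant, hfactor, resultant_C_mul_X_sub_C_mul_X_sub_C (natDegree_rileyPoly_le n m),
    eval_rileyPoly, eval_rileyPoly]

/-- Where the leading coefficient of `traceQuadratic` vanishes, its remaining root is `1`. -/
theorem eliminant_eq_of_mul_add_one_eq_zero (n : ℤ) {L m : R} (h : L * m + 1 = 0) :
    eliminant n L m = (-((L + 1) * (m + 1))) ^ rileyDegree n *
      ((rileyPoly n m).coeff (rileyDegree n) * ((-1) ^ rileyDegree n * riley n m 1)) := by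
  have hfactor : traceQuadratic L m = Polynomial.C (-((L + 1) * (m + 1))) *
      (Polynomial.X - Polynomial.C 1) := by
    have h' := congrArg Polynomial.C h
    simp only [traceQuadratic, map_mul, map_add, map_neg, map_sub, map_one, map_zero] at h' ⊢
    linear_combination (Polynomial.X ^ 2 - 2) * h'
  rw [eliminant, hfactor, resultant_C_mul_X_sub_C (natDegree_rileyPoly_le n m), eval_rileyPoly]

theorem eliminant_eq_zero (n : ℤ) {L m y : R}
    (hq : (L * m + 1) * y ^ 2 - (L + 1) * (m + 1) * y - (L - 1) * (m - 1) = 0)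
    (hr : riley n m y = 0) : eliminant n L m = 0 := by
  obtain ⟨p, q, -, -, h⟩ := Polynomial.exists_mul_add_mul_eq_C_resultant (rileyPoly n m)
    (traceQuadratic L m) (natDegree_rileyPoly_le n m) (natDegree_traceQuadratic_le L m)
    (Or.inr two_ne_zero)
  have heval := congrArg (Polynomial.eval y) h
  rw [Polynomial.eval_C, Polynomial.eval_add, Polynomial.eval_mul, Polynomial.eval_mul,
    eval_rileyPoly, eval_traceQuadratic, hq, hr] at heval
  rw [eliminant, ← heval]
  ring

theorem eliminant_one_right [Nontrivial R] (n : ℤ) (L : R) :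
    eliminant n L 1 = (L + 1) ^ rileyDegree n := by
  rw [eliminant_eq_mul n (y₁ := 0) (y₂ := 2) (by ring) (by ring), riley_zero_right, riley_one_two]
  simp

theorem eliminant_zero_neg_one_ne_zero (n : ℤ) : eliminant n (0 : ℂ) (-1) ≠ 0 := by
  obtain ⟨w, hw⟩ := IsAlgClosed.exists_pow_nat_eq (2 : ℂ) (n := 2) (by norm_num)
  rw [eliminant_eq_mul n (y₁ := w) (y₂ := -w) (by ring) (by linear_combination -hw),
    riley_neg_one n hw, riley_neg_one n (by linear_combination hw)]
  simp

theorem eliminant_five_halves_zero_ne_zero (n : ℤ) : eliminant n (5 / 2 : ℂ) 0 ≠ 0 := by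
  rw [eliminant_eq_mul n (y₁ := 3) (y₂ := 1 / 2) (by norm_num) (by norm_num)]
  refine mul_ne_zero (by simp) (mul_ne_zero ?_ ?_) <;>
    apply riley_zero_left_ne_zero <;> norm_num

/-- The point is chosen with `M ^ 2` a primitive sixth root of unity, so that `traceGap` vanishes at
the remaining root `1` of `traceQuadratic`. -/
theorem exists_eliminant_ne_zero_of_mul_sq_add_one_eq_zero (n : ℤ) :
    ∃ L M : ℂ, L * M ^ 2 + 1 = 0 ∧ eliminant n L (M ^ 2) ≠ 0 := by
  obtain ⟨w, hw⟩ := IsAlgClosed.exists_pow_nat_eq (-3 : ℂ) (n := 2) (by norm_num)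
  obtain ⟨M, hM⟩ := IsAlgClosed.exists_pow_nat_eq ((1 + w) / 2) (n := 2) (by norm_num)
  have hsixth : (M ^ 2) ^ 2 - M ^ 2 + 1 = 0 := by rw [hM]; linear_combination hw / 4
  generalize hm : M ^ 2 = m at hsixth
  have h0 : m ≠ 0 := by rintro rfl; norm_num at hsixth
  have h1 : m - 1 ≠ 0 := fun h ↦ by rw [sub_eq_zero.mp h] at hsixth; norm_num at hsixth
  have h2 : m + 1 ≠ 0 := fun h ↦ by
    rw [eq_neg_of_add_eq_zero_left h] at hsixth; norm_num at hsixth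
  have hgap : traceGap m 1 = 0 := by unfold traceGap; linear_combination -hsixth
  have hL : -1 / m * m + 1 = 0 := by field_simp; ring
  have hL1 : -1 / m + 1 ≠ 0 := by
    rw [show -1 / m + 1 = (m - 1) / m by field_simp; ring]
    exact div_ne_zero h1 h0
  have hcoeff : (rileyPoly n m).coeff (rileyDegree n) ≠ 0 := by
    rcases coeff_rileyPoly_eq_or_eq_neg n m with h | h <;> rw [h] <;> simp [h0]
  refine ⟨-1 / m, M, by rw [hm, hL], ?_⟩
  rw [hm, eliminant_eq_of_mul_add_one_eq_zero n hL, riley_of_twistTrace_eq_zero n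
    (by rw [twistTrace, hgap]; ring) (by rw [rileyFactor, hgap]; ring)]
  simp [hL1, h2, hcoeff, h0]

end Eliminant

theorem exists_riley_eq_zero_of_eliminant_eq_zero {K : Type*} [Field K] [IsAlgClosed K] {n : ℤ}
    {L m : K} (hQ : L * m + 1 ≠ 0) (h : eliminant n L m = 0) :
    ∃ y, (L * m + 1) * y ^ 2 - (L + 1) * (m + 1) * y - (L - 1) * (m - 1) = 0 ∧
      riley n m y = 0 := by
  obtain ⟨y, hy⟩ := IsAlgClosed.exists_root (Polynomial.C (L * m + 1) * Polynomial.X ^ 2 +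
    Polynomial.C (-((L + 1) * (m + 1))) * Polynomial.X + Polynomial.C (-((L - 1) * (m - 1))))
    (by rw [Polynomial.degree_quadratic hQ]; decide)
  simp only [Polynomial.IsRoot, Polynomial.eval_add, Polynomial.eval_mul, Polynomial.eval_C,
    Polynomial.eval_pow, Polynomial.eval_X] at hy
  have hadd : (L * m + 1) * (y + ((L + 1) * (m + 1) / (L * m + 1) - y)) = (L + 1) * (m + 1) := by
    field_simp; ring
  generalize (L + 1) * (m + 1) / (L * m + 1) - y = y' at hadd
  rw [eliminant_eq_mul n hadd (by linear_combination y * hadd - hy)] at h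
  rcases mul_eq_zero.1 ((mul_eq_zero.1 h).resolve_left (pow_ne_zero _ hQ)) with hr | hr
  · exact ⟨y, by linear_combination hy, hr⟩
  · exact ⟨y', by linear_combination hy + (y' - y) * hadd, hr⟩

end ConwayKnot

theorem sum_range_two_mul_add_one {A : Type*} [AddCommMonoid A] (f : ℕ → A) (n : ℕ) :
    ∑ i ∈ Finset.range (2 * n + 1), f i =
      ∑ j ∈ Finset.range (n + 1), f (2 * j) + ∑ j ∈ Finset.range n, f (2 * j + 1) := by
  induction n with
  | zero => simp
  | succ n ih =>
    rw [show 2 * (n + 1) + 1 = 2 * n + 1 + 1 + 1 by ring, Finset.sum_range_succ,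
      Finset.sum_range_succ, ih, Finset.sum_range_succ (fun j ↦ f (2 * j + 1)) n,
      Finset.sum_range_succ (fun j ↦ f (2 * j)) (n + 1), show 2 * (n + 1) = 2 * n + 1 + 1 by ring,
      add_assoc _ _ (f (2 * n + 1)), add_right_comm]

namespace ConwayKnot

section Formula

variable {K : Type*} [Field K]

/-- The factors that the summands of index `i` in the two cases of `pFormula` have in common, with
`N = |n|`, `m = M ^ 2`, `Q = L * M ^ 2 + 1`, in terms of the `y` with
`z = 2 * Q * y - (L * M ^ 2 + L + M ^ 2 + 1)` and of `e = traceGap m y / m`. -/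
def formulaTerm (N : ℕ) (m Q y e : K) (i : ℕ) : K :=
  2 ^ (-2 * (((i : ℤ) + 1) / 2) - i) * m ^ (-((i : ℤ) / 2) - 2 * (((i : ℤ) + 1) / 2) + i + N)
    * Q ^ (-2 * (((i : ℤ) + 1) / 2) - i) * (2 * Q * (m * e)) ^ (((i : ℤ) + 1) / 2)
    * (2 * Q * y) ^ i * (2 * Q * (y - 2)) ^ (((i : ℤ) - 1) / 2)

theorem formulaTerm_two_mul (h2 : (2 : K) ≠ 0) (N : ℕ) {m Q y : K} (e : K) (hm : m ≠ 0)
    (hQ : Q ≠ 0) (hy : y - 2 ≠ 0) (j : ℕ) :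
    formulaTerm N m Q y e (2 * j) * (2 * Q * (y - 2)) = m ^ N * (e * y ^ 2 * (y - 2)) ^ j := by
  have hceil : (((2 * j : ℕ) : ℤ) + 1) / 2 = j := by lia
  have hfloor : ((2 * j : ℕ) : ℤ) / 2 = j := by lia
  have hlast : (((2 * j : ℕ) : ℤ) - 1) / 2 = j - 1 := by lia
  have hw : 2 * Q * (y - 2) ≠ 0 := mul_ne_zero (mul_ne_zero h2 hQ) hy
  rw [formulaTerm, hceil, hfloor, hlast, mul_assoc _ (_ ^ ((j : ℤ) - 1)), ← zpow_add_one₀ hw,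
    sub_add_cancel, show -2 * (j : ℤ) - (2 * j : ℕ) = -(4 * j : ℕ) by push_cast; ring,
    show -(j : ℤ) - 2 * j + (2 * j : ℕ) + N = -(j : ℤ) + N by push_cast; ring, zpow_add₀ hm]
  simp only [zpow_neg, zpow_natCast, mul_pow]
  field_simp
  ring

theorem formulaTerm_two_mul_add_one (h2 : (2 : K) ≠ 0) (N : ℕ) {m Q : K} (y e : K) (hm : m ≠ 0)
    (hQ : Q ≠ 0) (j : ℕ) : formulaTerm N m Q y e (2 * j + 1) * (2 * Q) =
      m ^ N * (e * y * (e * y ^ 2 * (y - 2)) ^ j) := by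
  have hceil : (((2 * j + 1 : ℕ) : ℤ) + 1) / 2 = (j + 1 : ℕ) := by lia
  have hfloor : ((2 * j + 1 : ℕ) : ℤ) / 2 = j := by lia
  have hlast : (((2 * j + 1 : ℕ) : ℤ) - 1) / 2 = j := by lia
  rw [formulaTerm, hceil, hfloor, hlast,
    show -2 * ((j + 1 : ℕ) : ℤ) - (2 * j + 1 : ℕ) = -(4 * j + 3 : ℕ) by push_cast; ring,
    show -(j : ℤ) - 2 * (j + 1 : ℕ) + (2 * j + 1 : ℕ) + N = -(j + 1 : ℕ) + N by
      push_cast; ring, zpow_add₀ hm]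
  simp only [zpow_neg, zpow_natCast, mul_pow]
  field_simp
  ring

theorem sum_mul_formulaTerm_mul (h2 : (2 : K) ≠ 0) (N : ℕ) {m Q y : K} (e : K) (hm : m ≠ 0)
    (hQ : Q ≠ 0) (hy : y - 2 ≠ 0) (c f : ℕ → K) {v : K} (hf : ∀ j, f (2 * j) = 2 * Q * (y - 2))
    (hf' : ∀ j, f (2 * j + 1) = 2 * Q * v) :
    ∑ i ∈ Finset.range (2 * N + 1), c i * (formulaTerm N m Q y e i * f i) =
      m ^ N * (∑ j ∈ Finset.range (N + 1), c (2 * j) * (e * y ^ 2 * (y - 2)) ^ j +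
        e * y * v * ∑ j ∈ Finset.range N, c (2 * j + 1) * (e * y ^ 2 * (y - 2)) ^ j) := by
  simp only [sum_range_two_mul_add_one, mul_add, Finset.mul_sum]
  congr 1 <;> refine Finset.sum_congr rfl fun j _ ↦ ?_
  · rw [hf, formulaTerm_two_mul h2 N e hm hQ hy]
    ring
  · rw [hf']
    linear_combination c (2 * j + 1) * v * formulaTerm_two_mul_add_one h2 N y e hm hQ j

variable {L M r y z : K}

theorem factors_pFormula {e : K} (he : traceGap (M ^ 2) y = M ^ 2 * e)
    (hz : z = 2 * (L * M ^ 2 + 1) * y - (L * M ^ 2 + L + M ^ 2 + 1)) :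
    -2 * L * M ^ 6 + L * M ^ 4 - L * M ^ 2 - M ^ 4 + M ^ 2 * z + M ^ 2 - 2 =
        2 * (L * M ^ 2 + 1) * (M ^ 2 * e) ∧
      L * M ^ 2 + L + M ^ 2 + z + 1 = 2 * (L * M ^ 2 + 1) * y ∧
      -3 * L * M ^ 2 + L + M ^ 2 + z - 3 = 2 * (L * M ^ 2 + 1) * (y - 2) := by
  subst hz
  refine ⟨?_, by ring, by ring⟩
  rw [← he, traceGap]
  ring

theorem pFormula_natCast_eq_sum (n : ℕ) (hr₀ : r ≠ 0) (hr : r ^ 2 = L * M ^ 2 + 1) {e : K}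
    (he : traceGap (M ^ 2) y = M ^ 2 * e)
    (hz : z = 2 * (L * M ^ 2 + 1) * y - (L * M ^ 2 + L + M ^ 2 + 1)) :
    pFormula n L M r z = r ^ (4 * n) * ∑ i ∈ Finset.range (2 * n + 1),
      ((Ring.choose ((i : ℤ) / 2 + n) i : ℤ) : K) *
        (formulaTerm n (M ^ 2) (L * M ^ 2 + 1) y e i *
          ((-1) ^ (i + 1) * (L * M ^ 2 + 1) - 2 * L * M ^ 2 + L + M ^ 2 + z - 2)) := by
  have hpow (a : ℤ) : (L * M ^ 2 + 1) ^ (a + 2 * (n : ℤ)) =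
      (L * M ^ 2 + 1) ^ a * r ^ (4 * n) := by
    rw [zpow_add₀ (hr ▸ pow_ne_zero _ hr₀), zpow_mul, zpow_natCast, ← hr, zpow_ofNat, ← pow_mul,
      ← pow_mul, show 2 * (2 * n) = 4 * n by ring]
  obtain ⟨hgap, hfst, hsnd⟩ := factors_pFormula he hz
  rw [pFormula, if_pos (by positivity), show (2 * (n : ℤ)).toNat = 2 * n by lia, Finset.mul_sum]
  refine Finset.sum_congr rfl fun i _ ↦ ?_
  rw [hgap, hfst, hsnd, hpow, formulaTerm]
  ring

theorem pFormula_negSucc_eq_sum (n : ℕ) (hr₀ : r ≠ 0) (hr : r ^ 2 = L * M ^ 2 + 1) {e : K}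
    (he : traceGap (M ^ 2) y = M ^ 2 * e)
    (hz : z = 2 * (L * M ^ 2 + 1) * y - (L * M ^ 2 + L + M ^ 2 + 1)) :
    pFormula (Int.negSucc n) L M r z =
      r ^ (4 * n + 3) * ∑ i ∈ Finset.range (2 * (n + 1) + 1),
        ((Ring.choose (((i : ℤ) - 1) / 2 - Int.negSucc n) i : ℤ) : K) *
          (formulaTerm (n + 1) (M ^ 2) (L * M ^ 2 + 1) y e i *
            ((-1) ^ i * (-2 * L * M ^ 2 + L + M ^ 2 + z - 2) - L * M ^ 2 - 1)) := by
  have hpow (a : ℤ) : r ^ (-1 + 2 * (a - 2 * Int.negSucc n)) =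
      (L * M ^ 2 + 1) ^ a * r ^ (4 * n + 3) := by
    rw [show -1 + 2 * (a - 2 * Int.negSucc n) = 2 * a + (4 * n + 3 : ℕ) by lia, zpow_add₀ hr₀,
      zpow_mul, zpow_natCast, ← hr, zpow_ofNat]
  obtain ⟨hgap, hfst, hsnd⟩ := factors_pFormula he hz
  rw [pFormula, if_neg (by lia), show (-2 * Int.negSucc n).toNat = 2 * (n + 1) by lia,
    Finset.mul_sum]
  refine Finset.sum_congr rfl fun i _ ↦ ?_
  simp only [hgap, hfst, hsnd, hpow, formulaTerm, sub_eq_add_neg _ (Int.negSucc n),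
    Int.neg_negSucc]
  ring

theorem pFormula_eq_mul_riley (n : ℤ) (h2 : (2 : K) ≠ 0) (hM : M ≠ 0) (hr₀ : r ≠ 0)
    (hr : r ^ 2 = L * M ^ 2 + 1) (hy : y - 2 ≠ 0)
    (hz : z = 2 * (L * M ^ 2 + 1) * y - (L * M ^ 2 + L + M ^ 2 + 1)) :
    pFormula n L M r z = r ^ rileyDegree n * riley n (M ^ 2) y := by
  have hm : M ^ 2 ≠ 0 := pow_ne_zero _ hM
  have hQ : L * M ^ 2 + 1 ≠ 0 := hr ▸ pow_ne_zero _ hr₀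
  obtain ⟨e, he⟩ : ∃ e, traceGap (M ^ 2) y = M ^ 2 * e :=
    ⟨traceGap (M ^ 2) y / M ^ 2, (mul_div_cancel₀ _ hm).symm⟩
  rw [riley_eq_chebyshevS n he rfl]
  rcases n with n | n
  · have heven (j : ℕ) : ((2 * j : ℕ) : ℤ) / 2 + n = (n + j : ℕ) := by lia
    have hodd (j : ℕ) : ((2 * j + 1 : ℕ) : ℤ) / 2 + n = (n + j : ℕ) := by lia
    rw [Int.ofNat_eq_natCast, pFormula_natCast_eq_sum n hr₀ hr he hz,
      sum_mul_formulaTerm_mul h2 n e hm hQ hy _ _ (v := y - 1)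
        (fun j ↦ by rw [Odd.neg_one_pow ⟨j, rfl⟩, hz]; ring)
        (fun j ↦ by rw [Even.neg_one_pow ⟨j + 1, by ring⟩, hz]; ring)]
    simp only [heven, hodd, Ring.choose_natCast, Int.cast_natCast, Int.natAbs_natCast,
      ← (eval_chebyshevS_two_add_eq_sum _ n).2, ← eval_chebyshevS_sub_one_two_add]
    simp only [← Int.ofNat_eq_natCast, rileyDegree]
    ring
  · have heven (j : ℕ) : (((2 * j : ℕ) : ℤ) - 1) / 2 - Int.negSucc n = (n + j : ℕ) := by lia
    have hodd (j : ℕ) : (((2 * j + 1 : ℕ) : ℤ) - 1) / 2 - Int.negSucc n = (n + 1 + j : ℕ) := by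
      lia
    rw [pFormula_negSucc_eq_sum n hr₀ hr he hz,
      sum_mul_formulaTerm_mul h2 (n + 1) e hm hQ hy _ _ (v := -(y - 1))
        (fun j ↦ by rw [Even.neg_one_pow ⟨j, by ring⟩, hz]; ring)
        (fun j ↦ by rw [Odd.neg_one_pow ⟨j, rfl⟩, hz]; ring)]
    simp only [heven, hodd, Ring.choose_natCast, Int.cast_natCast, Int.natAbs_negSucc]
    rw [Finset.sum_range_succ _ (n + 1), Nat.choose_eq_zero_of_lt (by lia), Nat.cast_zero, zero_mul,
      add_zero, ← (eval_chebyshevS_two_add_eq_sum _ n).1, ← (eval_chebyshevS_two_add_eq_sum _ n).2,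
      chebyshevS_negSucc, chebyshevS_negSucc_sub_one, Polynomial.eval_neg, Polynomial.eval_neg,
      rileyDegree, Nat.succ_eq_add_one]
    ring

theorem pFormula_mul_pFormula_neg (n : ℤ) {u : K} (h2 : (2 : K) ≠ 0) (hM : M ≠ 0)
    (hL₁ : L - 1 ≠ 0) (hM₁ : M ^ 2 - 1 ≠ 0) (hr₀ : r ≠ 0) (hr : r ^ 2 = L * M ^ 2 + 1)
    (hu : u ^ 2 = uSquared L M) :
    pFormula n L M r u * pFormula n L M r (-u) = eliminant n L (M ^ 2) := by
  have hQ : L * M ^ 2 + 1 ≠ 0 := hr ▸ pow_ne_zero _ hr₀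
  have h2Q : 2 * (L * M ^ 2 + 1) ≠ 0 := mul_ne_zero h2 hQ
  have hroot (z : K) : ∃ y, z = 2 * (L * M ^ 2 + 1) * y - (L * M ^ 2 + L + M ^ 2 + 1) :=
    ⟨(z + (L * M ^ 2 + L + M ^ 2 + 1)) / (2 * (L * M ^ 2 + 1)), by
      rw [mul_div_cancel₀ _ h2Q]; ring⟩
  obtain ⟨y₁, hy₁⟩ := hroot u
  obtain ⟨y₂, hy₂⟩ := hroot (-u)
  have hadd : (L * M ^ 2 + 1) * (y₁ + y₂) = (L + 1) * (M ^ 2 + 1) := by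
    apply mul_left_cancel₀ h2
    linear_combination -hy₁ - hy₂
  have hmul : (L * M ^ 2 + 1) * (y₁ * y₂) = -((L - 1) * (M ^ 2 - 1)) := by
    apply mul_left_cancel₀ (mul_ne_zero h2 h2Q)
    unfold uSquared at hu
    linear_combination -(2 * (L * M ^ 2 + 1) * y₂) * hy₁ -
      (u + (L * M ^ 2 + L + M ^ 2 + 1)) * hy₂ - hu
  have hne : (y₁ - 2) * (y₂ - 2) ≠ 0 := by
    refine right_ne_zero_of_mul (a := L * M ^ 2 + 1) ?_
    rw [show (L * M ^ 2 + 1) * ((y₁ - 2) * (y₂ - 2)) = (L - 1) * (M ^ 2 - 1) by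
      linear_combination hmul - 2 * hadd]
    exact mul_ne_zero hL₁ hM₁
  rw [pFormula_eq_mul_riley n h2 hM hr₀ hr (left_ne_zero_of_mul hne) hy₁,
    pFormula_eq_mul_riley n h2 hM hr₀ hr (right_ne_zero_of_mul hne) hy₂,
    eliminant_eq_mul n hadd hmul, ← hr, mul_mul_mul_comm, ← pow_add, ← two_mul, pow_mul]

end Formula

/-- The polynomial `p_{2n}(u) p_{2n}(-u)`. -/
def curvePoly (n : ℤ) : PolyLM := eliminant n (X 0) (X 1 ^ 2)

theorem aeval_curvePoly {A : Type*} [CommRing A] (n : ℤ) (v : Fin 2 → A) :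
    aeval v (curvePoly n) = eliminant n (v 0) (v 1 ^ 2) := by
  have := map_eliminant (aeval v : PolyLM →ₐ[ℤ] A).toRingHom n (X 0) (X 1 ^ 2)
  simpa [curvePoly] using this

theorem algebraMap_curvePoly (n : ℤ) :
    algebraMap PolyLM AlgFun (curvePoly n) = eliminant n Lfun (Mfun ^ 2) := by
  rw [curvePoly, map_eliminant, map_pow]
  rfl

theorem algebraMap_algFun_ne_zero {p : PolyLM} (v : Fin 2 → ℤ) (hp : aeval v p ≠ 0) :
    algebraMap PolyLM AlgFun p ≠ 0 := by
  have hinj : Function.Injective (algebraMap PolyLM AlgFun) := by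
    rw [IsScalarTower.algebraMap_eq PolyLM (FractionRing PolyLM) AlgFun, RingHom.coe_comp]
    exact (algebraMap (FractionRing PolyLM) AlgFun).injective.comp
      (IsFractionRing.injective PolyLM (FractionRing PolyLM))
  rw [map_ne_zero_iff _ hinj]
  rintro rfl
  simp at hp

theorem pFormula_mul_pFormula_neg_algFun (n : ℤ) {u r : AlgFun} (hu : u ^ 2 = uSquared Lfun Mfun)
    (hr : r ^ 2 = Lfun * Mfun ^ 2 + 1) :
    pFormula n Lfun Mfun r u * pFormula n Lfun Mfun r (-u) =
      algebraMap PolyLM AlgFun (curvePoly n) := by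
  have hM : Mfun ≠ 0 := algebraMap_algFun_ne_zero ![1, 1] (by simp)
  have hL₁ : Lfun - 1 ≠ 0 := by
    have := algebraMap_algFun_ne_zero (p := X 0 - 1) ![2, 1] (by simp)
    simpa [Lfun] using this
  have hM₁ : Mfun ^ 2 - 1 ≠ 0 := by
    have := algebraMap_algFun_ne_zero (p := X 1 ^ 2 - 1) ![2, 2] (by simp)
    simpa [Mfun] using this
  have hQ : Lfun * Mfun ^ 2 + 1 ≠ 0 := by
    have := algebraMap_algFun_ne_zero (p := X 0 * X 1 ^ 2 + 1) ![2, 2] (by simp)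
    simpa [Mfun, Lfun] using this
  have hr₀ : r ≠ 0 := by
    rintro rfl
    exact hQ (by simp [← hr])
  rw [algebraMap_curvePoly, pFormula_mul_pFormula_neg n two_ne_zero hM hL₁ hM₁ hr₀ hr hu]

end ConwayKnot

section PlaneCurves

theorem vanishingIdeal_le_span_of_irreducible {σ k : Type*} [Finite σ] [Field k] [IsAlgClosed k]
    {E : Set (σ → k)} {F H : MvPolynomial σ k} (hF : Irreducible F) (hH : ¬F ∣ H)
    (h : ∀ v, eval v F = 0 → eval v H ≠ 0 → v ∈ E) : vanishingIdeal k E ≤ Ideal.span {F} := by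
  have hprime : (Ideal.span {F}).IsPrime := (Ideal.span_singleton_prime hF.ne_zero).2 hF.prime
  intro G hG
  have hmul : G * H ∈ vanishingIdeal k (zeroLocus k (Ideal.span {F})) := by
    rw [mem_vanishingIdeal_iff]
    intro v hv
    have hFv : eval v F = 0 := by
      simpa using mem_zeroLocus_iff.1 hv F (Ideal.mem_span_singleton_self F)
    by_cases hHv : eval v H = 0
    · simp [aeval_eq_eval, hHv]
    · rw [map_mul, mem_vanishingIdeal_iff.1 hG v (h v hFv hHv), zero_mul]
  rw [vanishingIdeal_zeroLocus_eq_radical, hprime.radical, Ideal.mem_span_singleton] at hmul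
  exact Ideal.mem_span_singleton.2 ((hF.prime.dvd_or_dvd hmul).resolve_right hH)

variable {E : Set (Fin 2 → ℂ)} {F G H : MvPolynomial (Fin 2) ℂ}

theorem IsCurveComponent.of_irreducible (hF : Irreducible F) (hH : ¬F ∣ H)
    (h : ∀ v, eval v F = 0 → eval v H ≠ 0 → v ∈ E) (hG₀ : G ≠ 0) (hG : ∀ v ∈ E, eval v G = 0) :
    IsCurveComponent E F := by
  have hprime : (Ideal.span {F}).IsPrime := (Ideal.span_singleton_prime hF.ne_zero).2 hF.prime
  refine ⟨hF, ⟨hprime, vanishingIdeal_le_span_of_irreducible hF hH h⟩, ?_⟩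
  rintro q ⟨hq, hEq⟩ hqF
  have hGq : G ∈ q := hEq (mem_vanishingIdeal_iff.2 fun v hv ↦ by simpa using hG v hv)
  have hq₀ : q ≠ ⊥ := by
    rintro rfl
    exact hG₀ (by simpa using hGq)
  obtain ⟨x, hxq, hx⟩ := hq.exists_mem_prime_of_ne_bot hq₀
  have hFx : F ∣ x := Ideal.mem_span_singleton.1 (hqF hxq)
  have hxF : x ∣ F := (hF.associated_of_dvd hx.irreducible hFx).symm.dvd
  exact (Ideal.span_singleton_le_iff_mem q).2 (q.mem_of_dvd hxF hxq)

theorem IsCurveComponent.dvd (h : IsCurveComponent E F) (hG : ∀ v ∈ E, eval v G = 0) : F ∣ G :=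
  Ideal.mem_span_singleton.1
    (h.2.1.2 (mem_vanishingIdeal_iff.2 fun v hv ↦ by simpa using hG v hv))

theorem eval_map_intCast (v : Fin 2 → ℂ) (A : PolyLM) :
    eval v (map (Int.castRingHom ℂ) A) = aeval v A := by
  rw [eval_map, aeval_def]
  rfl

/-- The points that `G₁` and `G₂` have in common are isolated, so that they do not contribute to the
one-dimensional part. -/
theorem definesCurvePart_of_irreducible_dvd {A : PolyLM} {G₁ G₂ : MvPolynomial (Fin 2) ℂ}
    (hunit : ∃ v : Fin 2 → ℤ, IsUnit (aeval v A)) (hG₁ : G₁ ≠ 0)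
    (hG : ∀ F, Irreducible F → F ∣ G₁ → ¬F ∣ G₂)
    (hE : ∀ v ∈ E, aeval v A = 0 ∨ eval v G₁ = 0 ∧ eval v G₂ = 0)
    (hA : ∀ F, Irreducible F → F ∣ map (Int.castRingHom ℂ) A →
      ∃ H, ¬F ∣ H ∧ ∀ v, eval v F = 0 → eval v H ≠ 0 → v ∈ E) :
    DefinesCurvePart E A := by
  obtain ⟨v₀, hv₀⟩ := hunit
  have hA₀ : map (Int.castRingHom ℂ) A ≠ 0 := by
    rw [map_ne_zero_iff _ (map_injective _ Int.cast_injective)]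
    rintro rfl
    simp at hv₀
  have hE₁ : ∀ v ∈ E, eval v (map (Int.castRingHom ℂ) A * G₁) = 0 := fun v hv ↦ by
    rw [map_mul, eval_map_intCast]
    exact mul_eq_zero.2 ((hE v hv).imp_right And.left)
  have hE₂ : ∀ v ∈ E, eval v (map (Int.castRingHom ℂ) A * G₂) = 0 := fun v hv ↦ by
    rw [map_mul, eval_map_intCast]
    exact mul_eq_zero.2 ((hE v hv).imp_right And.right)
  refine ⟨?_, fun F hF ↦ ⟨fun hFA ↦ ?_, fun hcomp ↦ ?_⟩⟩
  · rintro c ⟨B, rfl⟩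
    rw [map_mul, aeval_C] at hv₀
    simpa using isUnit_of_mul_isUnit_left hv₀
  · obtain ⟨H, hH, h⟩ := hA F hF hFA
    exact .of_irreducible hF hH h (mul_ne_zero hA₀ hG₁) hE₁
  · rcases hF.prime.dvd_or_dvd (hcomp.dvd hE₁) with h | h₁
    · exact h
    · exact (hF.prime.dvd_or_dvd (hcomp.dvd hE₂)).resolve_right (hG F hF h₁)

end PlaneCurves

section SpecialLinearGroup

open Polynomial.Chebyshev (S)
open scoped MatrixGroups

variable {R : Type*} [CommRing R]

theorem upper_left_mul_lower_right {g : SL(2, R)} (hg : g.1 1 0 = 0) :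
    g.1 0 0 * g.1 1 1 = 1 := by
  have hdet := g.2
  rwa [Matrix.det_fin_two, hg, mul_zero, sub_zero] at hdet

theorem mul_apply_zero_of_apply_one_zero {A B : Matrix (Fin 2) (Fin 2) R} (hB : B 1 0 = 0)
    (i : Fin 2) : (A * B) i 0 = A i 0 * B 0 0 := by
  simp [Matrix.mul_apply, hB]

theorem coe_inv_eq_trace_smul_one_sub (g : SL(2, R)) : (g⁻¹).1 = g.1.trace • 1 - g.1 := by
  rw [Matrix.SpecialLinearGroup.coe_inv, Matrix.adjugate_fin_two, Matrix.trace_fin_two]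
  ext i j
  fin_cases i <;> fin_cases j <;> simp

theorem coe_mul_coe_self (g : SL(2, R)) : g.1 * g.1 = g.1.trace • g.1 - 1 := by
  have h : g.1 * (g⁻¹).1 = 1 := by
    rw [← Matrix.SpecialLinearGroup.coe_mul, mul_inv_cancel, Matrix.SpecialLinearGroup.coe_one]
  rw [coe_inv_eq_trace_smul_one_sub, mul_sub, Matrix.mul_smul, mul_one] at h
  rw [← h, sub_sub_cancel]

theorem coe_zpow_eq_chebyshevS (g : SL(2, R)) (n : ℤ) : (g ^ n).1 =
    (S R (n - 1)).eval g.1.trace • g.1 - (S R (n - 2)).eval g.1.trace • 1 := by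
  induction n using Int.induction_on with
  | zero => simp
  | succ n ih =>
    have hS : (S R n).eval g.1.trace =
        g.1.trace * (S R (n - 1)).eval g.1.trace - (S R (n - 2)).eval g.1.trace := by
      simpa using congrArg (Polynomial.eval g.1.trace) (Polynomial.Chebyshev.S_eq R n)
    rw [zpow_add_one, Matrix.SpecialLinearGroup.coe_mul, ih, add_sub_cancel_right,
      show (n : ℤ) + 1 - 2 = n - 1 by ring, hS, sub_mul, Matrix.smul_mul, Matrix.smul_mul, one_mul,
      coe_mul_coe_self]
    module
  | pred n ih =>
    have hS : (S R (-n - 1 - 2)).eval g.1.trace =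
        g.1.trace * (S R (-n - 2)).eval g.1.trace - (S R (-n - 1)).eval g.1.trace := by
      have h := congrArg (Polynomial.eval g.1.trace) (Polynomial.Chebyshev.S_sub_two R (-n - 1))
      rwa [show -(n : ℤ) - 1 - 1 = -n - 2 by ring, Polynomial.eval_sub, Polynomial.eval_mul,
        Polynomial.eval_X] at h
    rw [zpow_sub_one, Matrix.SpecialLinearGroup.coe_mul, ih, show -(n : ℤ) - 1 - 1 = -n - 2 by ring,
      hS, coe_inv_eq_trace_smul_one_sub, mul_sub, Matrix.mul_smul, mul_one, sub_mul,
      Matrix.smul_mul, Matrix.smul_mul, one_mul, coe_mul_coe_self]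
    module

theorem lower_left_mul_eq_of_zpow_mul_eq [IsDomain R] {r s l : SL(2, R)} {n : ℤ}
    (h : r ^ n * l = s⁻¹ * r ^ n * s) (hl : l.1 1 0 = 0)
    (hS : (S R (n - 1)).eval r.1.trace ≠ 0) : r.1 1 0 * l.1 0 0 = (s⁻¹ * r * s).1 1 0 := by
  have hs : (s⁻¹).1 * s.1 = 1 := by
    rw [← Matrix.SpecialLinearGroup.coe_mul, inv_mul_cancel, Matrix.SpecialLinearGroup.coe_one]
  have hcoe := congrArg Subtype.val h
  rw [Matrix.SpecialLinearGroup.coe_mul, Matrix.SpecialLinearGroup.coe_mul,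
    Matrix.SpecialLinearGroup.coe_mul, coe_zpow_eq_chebyshevS, mul_sub, sub_mul, sub_mul,
    Matrix.mul_smul, Matrix.mul_smul, mul_one, Matrix.smul_mul, Matrix.smul_mul, Matrix.smul_mul,
    Matrix.smul_mul, one_mul, hs] at hcoe
  have hentry := congrFun (congrFun hcoe 1) 0
  refine mul_left_cancel₀ hS ?_
  simpa [hl, mul_apply_zero_of_apply_one_zero] using hentry

theorem trace_coe_conj (g h : SL(2, R)) : (MulAut.conj g h).1.trace = h.1.trace := by
  rw [MulAut.conj_apply, Matrix.SpecialLinearGroup.coe_mul, Matrix.trace_mul_comm,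
    ← Matrix.SpecialLinearGroup.coe_mul, inv_mul_cancel_left]

theorem matrix_fin_two_congr {α : Type*} {w x y z w' x' y' z' : α} (hw : w = w') (hx : x = x')
    (hy : y = y') (hz : z = z') : !![w, x; y, z] = !![w', x'; y', z'] := by
  rw [hw, hx, hy, hz]

theorem coe_conj_of_coe_eq_shear {P : SL(2, R)} {k : R} (hP : P.1 = !![1, k; 0, 1])
    (g : SL(2, R)) : (MulAut.conj P g).1 =
      !![g.1 0 0 + k * g.1 1 0, -k * (g.1 0 0 + k * g.1 1 0) + (g.1 0 1 + k * g.1 1 1);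
        g.1 1 0, -k * g.1 1 0 + g.1 1 1] := by
  rw [MulAut.conj_apply, Matrix.SpecialLinearGroup.coe_mul, Matrix.SpecialLinearGroup.coe_mul,
    Matrix.SpecialLinearGroup.coe_inv, hP, Matrix.adjugate_fin_two_of, Matrix.eta_fin_two g.1,
    Matrix.mul_fin_two, Matrix.mul_fin_two]
  refine matrix_fin_two_congr ?_ ?_ ?_ ?_ <;> simp [mul_comm]

theorem eq_smul_one_of_fin_two {A : Matrix (Fin 2) (Fin 2) R} (h01 : A 0 1 = 0) (h10 : A 1 0 = 0)
    (h11 : A 1 1 = A 0 0) : A = A 0 0 • (1 : Matrix (Fin 2) (Fin 2) R) := by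
  ext i j
  fin_cases i <;> fin_cases j <;> simp [h01, h10, h11]

theorem exists_conj_eq_diagonal {K : Type*} [Field K] {a : SL(2, K)} (ha : a.1 1 0 = 0)
    (hsq : a.1 0 0 ^ 2 ≠ 1) : ∃ P : SL(2, K),
      (MulAut.conj P a).1 = !![a.1 0 0, 0; 0, (a.1 0 0)⁻¹] ∧
      ∀ g : SL(2, K), g.1 1 0 = 0 →
        (MulAut.conj P g).1 1 0 = 0 ∧ (MulAut.conj P g).1 0 0 = g.1 0 0 := by
  have hdet := upper_left_mul_lower_right ha
  have hM := left_ne_zero_of_mul_eq_one hdet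
  have hinv : a.1 1 1 = (a.1 0 0)⁻¹ := eq_inv_of_mul_eq_one_right hdet
  have hgap : a.1 0 0 - (a.1 0 0)⁻¹ ≠ 0 := fun h ↦ hsq <| by
    rw [sq]
    nth_rw 2 [sub_eq_zero.mp h]
    exact mul_inv_cancel₀ hM
  let P : SL(2, K) := ⟨!![1, a.1 0 1 / (a.1 0 0 - (a.1 0 0)⁻¹); 0, 1], by simp⟩
  refine ⟨P, ?_, fun g hg ↦ ?_⟩
  · rw [coe_conj_of_coe_eq_shear (P := P) rfl, ha, hinv]
    refine matrix_fin_two_congr (by ring) ?_ rfl (by ring)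
    linear_combination -div_mul_cancel₀ (a.1 0 1) hgap
  · rw [coe_conj_of_coe_eq_shear (P := P) rfl]
    simp [hg]

end SpecialLinearGroup

namespace ConwayKnot

section GroupWords

variable {G H : Type*} [Group G] [Group H]

/-- The product of a meridian `c` and the inverse of a meridian `a`: the word by which two of the
four crossings of the second twist region conjugate. -/
def twistS (a c : G) : G := c * a⁻¹

/-- The word by which two crossings of the first twist region conjugate. -/
def twistR (a c : G) : G := a⁻¹ * twistS a c ^ 2 * a * (twistS a c ^ 2)⁻¹

/-- The one relation between the meridians `a` and `c` that generate the knot group. -/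
def KnotRelation (n : ℤ) (a c : G) : Prop := c * twistR a c ^ n = twistR a c ^ n * a

/-- The null-homologous longitude as a word in the two generating meridians. -/
def pairLongitude (n : ℤ) (a c : G) : G :=
  (twistR a c ^ n)⁻¹ * (twistS a c ^ 2)⁻¹ * twistR a c ^ n * twistS a c ^ 2

theorem map_twistR (f : G →* H) (a c : G) : f (twistR a c) = twistR (f a) (f c) := by
  simp [twistR, twistS]

theorem map_pairLongitude (f : G →* H) (n : ℤ) (a c : G) :
    f (pairLongitude n a c) = pairLongitude n (f a) (f c) := by
  simp [pairLongitude, twistS, map_twistR]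

theorem KnotRelation.map {n : ℤ} {a c : G} (h : KnotRelation n a c) (f : G →* H) :
    KnotRelation n (f a) (f c) := by
  simpa [KnotRelation, map_twistR] using congrArg f h

theorem KnotRelation.self (n : ℤ) (a : G) : KnotRelation n a a := by
  simp [KnotRelation, twistR, twistS]

theorem pairLongitude_self (n : ℤ) (a : G) : pairLongitude n a a = 1 := by
  simp [pairLongitude, twistR, twistS]

theorem mul_twistR (a c : G) : c * twistR a c = twistS a c ^ 2 * c * (twistS a c ^ 2)⁻¹ := by
  have hc : twistS a c * a = c := inv_mul_cancel_right c a
  calc c * twistR a c = twistS a c * twistS a c ^ 2 * a * (twistS a c ^ 2)⁻¹ := by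
        rw [twistR, ← mul_assoc, ← mul_assoc, ← mul_assoc]; rfl
    _ = twistS a c ^ 2 * (twistS a c * a) * (twistS a c ^ 2)⁻¹ := by group
    _ = _ := by rw [hc]

theorem twistS_sq_conj (a c : G) : twistS a c ^ 2 * a * (twistS a c ^ 2)⁻¹ = a * twistR a c := by
  simp only [twistR]; group

theorem zpow_mul_pairLongitude (n : ℤ) (a c : G) : twistR a c ^ n * pairLongitude n a c =
    (twistS a c ^ 2)⁻¹ * twistR a c ^ n * twistS a c ^ 2 := by
  rw [pairLongitude]; group

theorem KnotRelation.pairLongitude_commute {n : ℤ} {a c : G} (h : KnotRelation n a c) :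
    Commute (pairLongitude n a c) a := by
  have hs : SemiconjBy (twistS a c ^ 2) a (a * twistR a c) :=
    (eq_mul_inv_iff_mul_eq.mp (twistS_sq_conj a c).symm).symm
  have hs' : SemiconjBy (twistS a c ^ 2) c (c * twistR a c) :=
    (eq_mul_inv_iff_mul_eq.mp (mul_twistR a c)).symm
  have hr : SemiconjBy (twistR a c ^ n) a c := h.symm
  have hr' : SemiconjBy (twistR a c ^ n) (a * twistR a c) (c * twistR a c) :=
    hr.mul_right (Commute.zpow_self _ n)
  have : SemiconjBy (pairLongitude n a c) a a :=
    ((hr.inv_symm_left.mul_left hs'.inv_symm_left).mul_left hr').mul_left hs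
  exact this

end GroupWords

section MatrixPairs

open Polynomial.Chebyshev (S)
open scoped MatrixGroups

/-- The normal form of a pair of noncommuting meridians whose first member is diagonalizable: `a` is
diagonal, `c` has the same trace, and `y` is the trace of `c * a⁻¹`. -/
structure MatrixPair {K : Type*} [Field K] (a c : SL(2, K)) (M p β γ δ y : K) : Prop where
  ne_zero : M ≠ 0
  coe_left : a.1 = !![M, 0; 0, M⁻¹]
  coe_right : c.1 = !![p, β; γ, δ]
  trace_eq : δ = M + M⁻¹ - p
  mul_eq : β * γ = (p - M) * (M⁻¹ - p)
  y_eq : y = p * M⁻¹ + δ * M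

namespace MatrixPair

variable {K : Type*} [Field K] {a c : SL(2, K)} {M p β γ δ y : K} {n : ℤ}

theorem coe_twistS_sq (h : MatrixPair a c M p β γ δ y) : (twistS a c ^ 2).1 =
    !![y * p * M⁻¹ - 1, y * β * M; y * γ * M⁻¹, y * δ * M - 1] := by
  have hS : (twistS a c).1 = !![p * M⁻¹, β * M; γ * M⁻¹, δ * M] := by
    rw [twistS, Matrix.SpecialLinearGroup.coe_mul, Matrix.SpecialLinearGroup.coe_inv, h.coe_left,
      h.coe_right, Matrix.adjugate_fin_two_of, Matrix.mul_fin_two]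
    simp
  have htrace : (twistS a c).1.trace = y := by rw [hS, Matrix.trace_fin_two_of, h.y_eq]
  rw [sq, Matrix.SpecialLinearGroup.coe_mul, coe_mul_coe_self, htrace, hS, Matrix.one_fin_two,
    Matrix.smul_of, Matrix.of_sub_of]
  simp [mul_assoc]

theorem twistS_sq_diagonal_mul (h : MatrixPair a c M p β γ δ y) :
    (y * p * M⁻¹ - 1) * (y * δ * M - 1) = 1 + y ^ 2 * ((p - M) * (M⁻¹ - p)) := by
  have := h.ne_zero
  rw [h.y_eq, h.trace_eq]
  field_simp
  ring

theorem twistS_sq_antidiagonal_mul (h : MatrixPair a c M p β γ δ y) :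
    (y * β * M) * (y * γ * M⁻¹) = y ^ 2 * ((p - M) * (M⁻¹ - p)) := by
  have := h.ne_zero
  rw [← h.mul_eq]
  field_simp

theorem coe_twistR (h : MatrixPair a c M p β γ δ y) : (twistR a c).1 =
    !![1 + (1 - M⁻¹ ^ 2) * y ^ 2 * ((p - M) * (M⁻¹ - p)),
      (M⁻¹ ^ 2 - 1) * (y * p * M⁻¹ - 1) * (y * β * M);
      (M ^ 2 - 1) * (y * γ * M⁻¹) * (y * δ * M - 1),
      1 + (1 - M ^ 2) * y ^ 2 * ((p - M) * (M⁻¹ - p))] := by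
  have hdiag := h.twistS_sq_diagonal_mul
  have hanti := h.twistS_sq_antidiagonal_mul
  have hMM := mul_inv_cancel₀ h.ne_zero
  rw [twistR, Matrix.SpecialLinearGroup.coe_mul, Matrix.SpecialLinearGroup.coe_mul,
    Matrix.SpecialLinearGroup.coe_mul, Matrix.SpecialLinearGroup.coe_inv,
    Matrix.SpecialLinearGroup.coe_inv, h.coe_twistS_sq, h.coe_left, Matrix.adjugate_fin_two_of,
    Matrix.adjugate_fin_two_of, Matrix.mul_fin_two, Matrix.mul_fin_two, Matrix.mul_fin_two]
  generalize y * p * M⁻¹ - 1 = s₁ at *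
  generalize y * δ * M - 1 = s₄ at *
  generalize y * β * M = s₂ at *
  generalize y * γ * M⁻¹ = s₃ at *
  generalize (p - M) * (M⁻¹ - p) = t at *
  refine matrix_fin_two_congr ?_ ?_ ?_ ?_
  · linear_combination s₁ * s₄ * hMM + hdiag - M⁻¹ ^ 2 * hanti
  · linear_combination (-s₁ * s₂) * hMM
  · linear_combination (-s₃ * s₄) * hMM
  · linear_combination s₁ * s₄ * hMM + hdiag - M ^ 2 * hanti

theorem trace_twistR (h : MatrixPair a c M p β γ δ y) : (twistR a c).1.trace =
    2 + (y + 2 - (M + M⁻¹) ^ 2) * y ^ 2 * (y - 2) := by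
  have := h.ne_zero
  rw [h.coe_twistR, Matrix.trace_fin_two_of, h.y_eq, h.trace_eq]
  field_simp
  ring

theorem twistR_defect (h : MatrixPair a c M p β γ δ y) :
    c.1 * (twistR a c).1 - (twistR a c).1 * a.1 = ((twistR a c).1.trace - 1 +
      (y + 2 - (M + M⁻¹) ^ 2) * y * (y - 1)) • (c.1 - a.1) := by
  rw [h.trace_twistR, h.coe_twistR, h.coe_left, h.coe_right, Matrix.mul_fin_two, Matrix.mul_fin_two,
    Matrix.of_sub_of, Matrix.of_sub_of, Matrix.smul_of]
  have hβ (x z : K) : β * (x * (y * γ * M⁻¹) * z) =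
      (p - M) * (M⁻¹ - p) * x * y * M⁻¹ * z := by rw [← h.mul_eq]; ring
  have hγ (x z : K) : γ * (x * z * (y * β * M)) =
      (p - M) * (M⁻¹ - p) * x * y * M * z := by rw [← h.mul_eq]; ring
  have := h.ne_zero
  simp only [Matrix.sub_cons, Matrix.smul_cons, Matrix.head_cons, Matrix.tail_cons, sub_self,
    Matrix.zero_empty, smul_eq_mul, Matrix.smul_empty]
  refine matrix_fin_two_congr ?_ ?_ ?_ ?_
  · rw [hβ, h.y_eq, h.trace_eq]; field_simp; ring
  · rw [h.y_eq, h.trace_eq]; field_simp; ring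
  · rw [h.y_eq, h.trace_eq]; field_simp; ring
  · rw [hγ, h.y_eq, h.trace_eq]; field_simp; ring

theorem twistR_zpow_defect (h : MatrixPair a c M p β γ δ y) (n : ℤ) :
    c.1 * (twistR a c ^ n).1 - (twistR a c ^ n).1 * a.1 =
      ((S K n).eval (twistR a c).1.trace + ((y + 2 - (M + M⁻¹) ^ 2) * y * (y - 1) - 1) *
        (S K (n - 1)).eval (twistR a c).1.trace) • (c.1 - a.1) := by
  have hS : (S K n).eval (twistR a c).1.trace = (twistR a c).1.trace *
      (S K (n - 1)).eval (twistR a c).1.trace - (S K (n - 2)).eval (twistR a c).1.trace := by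
    simpa using congrArg (Polynomial.eval (twistR a c).1.trace) (Polynomial.Chebyshev.S_eq K n)
  have hdefect : c.1 * (twistR a c ^ n).1 - (twistR a c ^ n).1 * a.1 =
      (S K (n - 1)).eval (twistR a c).1.trace •
        (c.1 * (twistR a c).1 - (twistR a c).1 * a.1) -
      (S K (n - 2)).eval (twistR a c).1.trace • (c.1 - a.1) := by
    rw [coe_zpow_eq_chebyshevS, mul_sub, sub_mul, Matrix.mul_smul, Matrix.mul_smul,
      Matrix.smul_mul, Matrix.smul_mul, one_mul, mul_one]
    module
  rw [hdefect, h.twistR_defect, hS]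
  module

theorem riley_eq (h : MatrixPair a c M p β γ δ y) (n : ℤ) : riley n (M ^ 2) y =
    (M ^ 2) ^ n.natAbs * ((S K n).eval (twistR a c).1.trace +
      ((y + 2 - (M + M⁻¹) ^ 2) * y * (y - 1) - 1) *
        (S K (n - 1)).eval (twistR a c).1.trace) := by
  have := h.ne_zero
  exact riley_eq_chebyshevS n (by rw [traceGap]; field_simp; ring) h.trace_twistR

theorem riley_eq_zero_iff (h : MatrixPair a c M p β γ δ y) (n : ℤ) : riley n (M ^ 2) y = 0 ↔
    (S K n).eval (twistR a c).1.trace + ((y + 2 - (M + M⁻¹) ^ 2) * y * (y - 1) - 1) *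
      (S K (n - 1)).eval (twistR a c).1.trace = 0 := by
  rw [h.riley_eq, mul_eq_zero, or_iff_right (pow_ne_zero _ (pow_ne_zero _ h.ne_zero))]

theorem knotRelation_iff (h : MatrixPair a c M p β γ δ y) (n : ℤ) (hac : c ≠ a) :
    KnotRelation n a c ↔ riley n (M ^ 2) y = 0 := by
  have hne : c.1 - a.1 ≠ 0 := fun h0 ↦ hac (Subtype.ext (sub_eq_zero.1 h0))
  rw [h.riley_eq_zero_iff, ← smul_eq_zero_iff_left hne, ← h.twistR_zpow_defect, sub_eq_zero,
    ← Matrix.SpecialLinearGroup.coe_mul, ← Matrix.SpecialLinearGroup.coe_mul]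
  exact Subtype.ext_iff

theorem eval_chebyshevS_ne_zero (h : MatrixPair a c M p β γ δ y) (hr : riley n (M ^ 2) y = 0) :
    (S K (n - 1)).eval (twistR a c).1.trace ≠ 0 := by
  intro hpred
  have hself := (h.riley_eq_zero_iff n).mp hr
  rw [hpred, mul_zero, add_zero] at hself
  have hunit := congrArg (Polynomial.eval (twistR a c).1.trace)
    (Polynomial.Chebyshev.S_sq_add_S_sq K (n - 1))
  simp [hpred, hself] at hunit

theorem y_ne_zero (h : MatrixPair a c M p β γ δ y) (hr : riley n (M ^ 2) y = 0) : y ≠ 0 := by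
  rintro rfl
  rw [riley_zero_right] at hr
  exact pow_ne_zero _ (pow_ne_zero _ h.ne_zero) hr

theorem longitude_relation (h : MatrixPair a c M p β γ δ y) (hr : riley n (M ^ 2) y = 0)
    (hl : (pairLongitude n a c).1 1 0 = 0) : (M ^ 2 - 1) * (y * γ * M⁻¹) *
      ((pairLongitude n a c).1 0 0 * (y * δ * M - 1) - (y * p * M⁻¹ - 1)) = 0 := by
  have hdiag := h.twistS_sq_diagonal_mul
  have hanti := h.twistS_sq_antidiagonal_mul
  have hentry := lower_left_mul_eq_of_zpow_mul_eq (zpow_mul_pairLongitude n a c) hl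
    (h.eval_chebyshevS_ne_zero hr)
  simp only [Matrix.SpecialLinearGroup.coe_mul, Matrix.SpecialLinearGroup.coe_inv, h.coe_twistS_sq,
    h.coe_twistR, Matrix.adjugate_fin_two_of, Matrix.mul_fin_two, Matrix.of_apply,
    Matrix.cons_val_zero, Matrix.cons_val_one] at hentry
  generalize (pairLongitude n a c).1 0 0 = L at *
  generalize y * p * M⁻¹ - 1 = s₁ at *
  generalize y * δ * M - 1 = s₄ at *
  generalize y * β * M = s₂ at *
  generalize y * γ * M⁻¹ = s₃ at *
  linear_combination hentry + (M ^ 2 - 1) * s₁ * s₃ * (hdiag - hanti) -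
    s₁ * s₃ * (M⁻¹ ^ 2 - M ^ 2) * hanti

theorem quadratic_eq (h : MatrixPair a c M p β γ δ y) (L : K) :
    (L * M ^ 2 + 1) * y ^ 2 - (L + 1) * (M ^ 2 + 1) * y - (L - 1) * (M ^ 2 - 1) =
      (M ^ 2 - 1) * (L * (y * δ * M - 1) - (y * p * M⁻¹ - 1)) := by
  have := h.ne_zero
  rw [h.y_eq, h.trace_eq]
  field_simp
  ring

theorem upper_left_pairLongitude_eq_one (h : MatrixPair a c M p β γ δ y) (hγ : γ = 0)
    (hl : (pairLongitude n a c).1 1 0 = 0) : (pairLongitude n a c).1 0 0 = 1 := by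
  have hs : (twistS a c ^ 2).1 1 0 = 0 := by rw [h.coe_twistS_sq]; simp [hγ]
  have hr : (twistR a c ^ n).1 1 0 = 0 := by
    rw [coe_zpow_eq_chebyshevS, h.coe_twistR]; simp [hγ]
  have hcomm : twistS a c ^ 2 * twistR a c ^ n * pairLongitude n a c =
      twistR a c ^ n * twistS a c ^ 2 := by
    rw [mul_assoc, zpow_mul_pairLongitude]; group
  have hentry := congrFun (congrFun (congrArg Subtype.val hcomm) 0) 0
  simp only [Matrix.SpecialLinearGroup.coe_mul, mul_apply_zero_of_apply_one_zero, hl, hr, hs]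
    at hentry
  refine mul_left_cancel₀ (mul_ne_zero
    (left_ne_zero_of_mul_eq_one (upper_left_mul_lower_right hs))
    (left_ne_zero_of_mul_eq_one (upper_left_mul_lower_right hr))) ?_
  rw [hentry, mul_one, mul_comm]

theorem y_eq_two_of_lower_left_eq_zero (h : MatrixPair a c M p β γ δ y) (hγ : γ = 0)
    (hr : riley n (M ^ 2) y = 0) : y = 2 := by
  have hM := h.ne_zero
  have hmul := h.mul_eq
  rw [hγ, mul_zero] at hmul
  rcases mul_eq_zero.1 hmul.symm with hp | hp
  · rw [h.y_eq, h.trace_eq, sub_eq_zero.1 hp]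
    field_simp
    ring
  · have hgap : traceGap (M ^ 2) y = 0 := by
      rw [traceGap, h.y_eq, h.trace_eq, ← sub_eq_zero.1 hp]
      field_simp
      ring
    rw [riley_of_twistTrace_eq_zero n (by rw [twistTrace, hgap]; ring)
      (by rw [rileyFactor, hgap]; ring)] at hr
    exact absurd hr (pow_ne_zero _ (pow_ne_zero _ hM))

theorem quadratic_upper_left_pairLongitude (h : MatrixPair a c M p β γ δ y)
    (hr : riley n (M ^ 2) y = 0) (hl : (pairLongitude n a c).1 1 0 = 0) :
    ((pairLongitude n a c).1 0 0 * M ^ 2 + 1) * y ^ 2 -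
      ((pairLongitude n a c).1 0 0 + 1) * (M ^ 2 + 1) * y -
      ((pairLongitude n a c).1 0 0 - 1) * (M ^ 2 - 1) = 0 := by
  by_cases hγ : γ = 0
  · rw [h.upper_left_pairLongitude_eq_one hγ hl, h.y_eq_two_of_lower_left_eq_zero hγ hr]
    ring
  · rw [h.quadratic_eq]
    apply mul_left_cancel₀
      (mul_ne_zero (mul_ne_zero (h.y_ne_zero hr) hγ) (inv_ne_zero h.ne_zero))
    linear_combination h.longitude_relation hr hl

theorem twistS_sq_lower_right_ne_zero [NeZero (2 : K)] (h : MatrixPair a c M p β γ δ y) {L : K}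
    (hplus : M ^ 2 + 1 ≠ 0) (hy : y ≠ 0) (hL : L * (y * δ * M - 1) - (y * p * M⁻¹ - 1) = 0) :
    y * δ * M - 1 ≠ 0 := by
  intro hlow
  have hup : y * p * M⁻¹ - 1 = 0 := by linear_combination L * hlow - hL
  have hsq : y ^ 2 = 2 := by linear_combination y * h.y_eq + hlow + hup
  have hquad := h.quadratic_eq 1
  rw [hlow, hup] at hquad
  have hy2 : y * (y - 2) = 0 :=
    (mul_eq_zero.1 (by linear_combination hquad)).resolve_left hplus
  have : (2 : K) = 0 := by
    linear_combination hsq - (y + 2) * (mul_eq_zero.1 hy2).resolve_left hy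
  exact two_ne_zero this

theorem upper_left_pairLongitude_eq [NeZero (2 : K)] (h : MatrixPair a c M p β γ δ y) {L : K}
    (hγ : γ ≠ 0) (hminus : M ^ 2 - 1 ≠ 0) (hplus : M ^ 2 + 1 ≠ 0)
    (hq : (L * M ^ 2 + 1) * y ^ 2 - (L + 1) * (M ^ 2 + 1) * y - (L - 1) * (M ^ 2 - 1) = 0)
    (hr : riley n (M ^ 2) y = 0) (hl : (pairLongitude n a c).1 1 0 = 0) :
    (pairLongitude n a c).1 0 0 = L := by
  have hy := h.y_ne_zero hr
  have hlong := (mul_eq_zero.1 (h.longitude_relation hr hl)).resolve_left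
    (mul_ne_zero hminus (mul_ne_zero (mul_ne_zero hy hγ) (inv_ne_zero h.ne_zero)))
  rw [h.quadratic_eq] at hq
  have hL := (mul_eq_zero.1 hq).resolve_left hminus
  apply mul_right_cancel₀ (h.twistS_sq_lower_right_ne_zero hplus hy hL)
  linear_combination hlong - hL

theorem lower_left_pairLongitude_eq_zero (h : MatrixPair a c M p β γ δ y)
    (hrel : KnotRelation n a c) (hminus : M ^ 2 - 1 ≠ 0) :
    (pairLongitude n a c).1 1 0 = 0 := by
  have hentry := congrFun (congrFun (congrArg Subtype.val hrel.pairLongitude_commute.eq) 1) 0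
  simp only [Matrix.SpecialLinearGroup.coe_mul, h.coe_left, Matrix.mul_apply, Fin.sum_univ_two,
    Matrix.of_apply, Matrix.cons_val_zero, Matrix.cons_val_one, mul_zero, zero_mul, add_zero,
    zero_add] at hentry
  refine (mul_eq_zero.1 ?_).resolve_left hminus
  linear_combination M * hentry + (pairLongitude n a c).1 1 0 * mul_inv_cancel₀ h.ne_zero

theorem not_commute (h : MatrixPair a c M p β γ δ y) (hγ : γ ≠ 0) (hminus : M ^ 2 - 1 ≠ 0) :
    ¬Commute a c := by
  intro hcomm
  have hentry := congrFun (congrFun (congrArg Subtype.val hcomm.eq) 1) 0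
  simp only [Matrix.SpecialLinearGroup.coe_mul, h.coe_left, h.coe_right, Matrix.mul_fin_two,
    Matrix.of_apply, Matrix.cons_val_zero, Matrix.cons_val_one, mul_zero, zero_mul, add_zero,
    zero_add] at hentry
  refine mul_ne_zero hγ hminus ?_
  linear_combination -M * hentry + γ * mul_inv_cancel₀ h.ne_zero

end MatrixPair

variable {K : Type*} [Field K] {n : ℤ}

theorem exists_matrixPair {M : K} (y : K) (hM : M ≠ 0) (hminus : M ^ 2 - 1 ≠ 0) :
    ∃ (a c : SL(2, K)) (p β δ : K), MatrixPair a c M p β 1 δ y := by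
  have hminus' : 1 - M ^ 2 ≠ 0 := by rwa [← neg_sub, neg_ne_zero]
  set p := M * (y - M ^ 2 - 1) / (1 - M ^ 2) with hp
  refine ⟨⟨!![M, 0; 0, M⁻¹], ?_⟩, ⟨!![p, (p - M) * (M⁻¹ - p); 1, M + M⁻¹ - p], ?_⟩,
    p, _, _, hM, rfl, rfl, rfl, mul_one _, ?_⟩
  · rw [Matrix.det_fin_two_of]; field_simp; ring
  · rw [Matrix.det_fin_two_of]; field_simp; ring
  · rw [hp]; field_simp; ring

theorem exists_pair_of_riley_eq_zero [NeZero (2 : K)] {L M y : K} (hM : M ≠ 0)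
    (hminus : M ^ 2 - 1 ≠ 0) (hplus : M ^ 2 + 1 ≠ 0)
    (hq : (L * M ^ 2 + 1) * y ^ 2 - (L + 1) * (M ^ 2 + 1) * y - (L - 1) * (M ^ 2 - 1) = 0)
    (hr : riley n (M ^ 2) y = 0) :
    ∃ a c : SL(2, K), KnotRelation n a c ∧ ¬Commute a c ∧ a.1 1 0 = 0 ∧ a.1 0 0 = M ∧
      (pairLongitude n a c).1 1 0 = 0 ∧ (pairLongitude n a c).1 0 0 = L := by
  obtain ⟨a, c, p, β, δ, h⟩ := exists_matrixPair y hM hminus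
  have hnc := h.not_commute one_ne_zero hminus
  have hac : c ≠ a := by rintro rfl; exact hnc (Commute.refl c)
  have hrel := (h.knotRelation_iff n hac).2 hr
  have hl := h.lower_left_pairLongitude_eq_zero hrel hminus
  exact ⟨a, c, hrel, hnc, by simp [h.coe_left], by simp [h.coe_left], hl,
    h.upper_left_pairLongitude_eq one_ne_zero hminus hplus hq hr hl⟩

theorem KnotRelation.trace_eq {a c : SL(2, K)} (h : KnotRelation n a c) :
    c.1.trace = a.1.trace := by
  have hrel : c * twistR a c ^ n = twistR a c ^ n * a := h
  rw [← trace_coe_conj (twistR a c ^ n) a, MulAut.conj_apply, ← hrel, mul_inv_cancel_right]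

theorem KnotRelation.exists_matrixPair {a c : SL(2, K)} {M : K} (h : KnotRelation n a c)
    (hM : M ≠ 0) (ha : a.1 = !![M, 0; 0, M⁻¹]) :
    ∃ p β γ δ y : K, MatrixPair a c M p β γ δ y := by
  have htrace := h.trace_eq
  have hdet := c.2
  rw [ha, Matrix.trace_fin_two, Matrix.trace_fin_two_of] at htrace
  have hδ : c.1 1 1 = M + M⁻¹ - c.1 0 0 := by linear_combination htrace
  rw [Matrix.det_fin_two, hδ] at hdet
  exact ⟨_, _, _, _, _, hM, ha, Matrix.eta_fin_two _, hδ,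
    by linear_combination -hdet + mul_inv_cancel₀ hM, rfl⟩

theorem KnotRelation.eliminant_eq_zero {a c : SL(2, K)} (h : KnotRelation n a c) (hac : c ≠ a)
    (ha : a.1 1 0 = 0) (hsq : a.1 0 0 ^ 2 ≠ 1) (hl : (pairLongitude n a c).1 1 0 = 0) :
    eliminant n ((pairLongitude n a c).1 0 0) (a.1 0 0 ^ 2) = 0 := by
  have hM := left_ne_zero_of_mul_eq_one (upper_left_mul_lower_right ha)
  obtain ⟨P, hdiag, hP⟩ := exists_conj_eq_diagonal ha hsq
  have hrel : KnotRelation n (MulAut.conj P a) (MulAut.conj P c) :=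
    h.map (MulAut.conj P).toMonoidHom
  have hmap : MulAut.conj P (pairLongitude n a c) =
      pairLongitude n (MulAut.conj P a) (MulAut.conj P c) :=
    map_pairLongitude (MulAut.conj P).toMonoidHom n a c
  obtain ⟨p, β, γ, δ, y, hpair⟩ := hrel.exists_matrixPair hM hdiag
  obtain ⟨hl', hL⟩ := hP _ hl
  rw [hmap] at hl' hL
  have hr := (hpair.knotRelation_iff n ((MulAut.conj P).injective.ne hac)).1 hrel
  rw [← hL]
  exact ConwayKnot.eliminant_eq_zero n (hpair.quadratic_upper_left_pairLongitude hr hl') hr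

theorem KnotRelation.sq_upper_left_pairLongitude_eq_one {a c : SL(2, K)} (h : KnotRelation n a c)
    (hac : c ≠ a) (ha : a.1 1 0 = 0) (hsq : a.1 0 0 ^ 2 = 1)
    (hl : (pairLongitude n a c).1 1 0 = 0) : (pairLongitude n a c).1 0 0 ^ 2 = 1 := by
  have hdet := upper_left_mul_lower_right ha
  have h11 : a.1 1 1 = a.1 0 0 := by
    apply mul_left_cancel₀ (left_ne_zero_of_mul_eq_one hdet)
    rw [hdet, ← sq, hsq]
  have h01 : a.1 0 1 ≠ 0 := fun h01 ↦ hac <| by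
    have hcentral (g : SL(2, K)) : g * a = a * g := by
      apply Subtype.ext
      rw [Matrix.SpecialLinearGroup.coe_mul, Matrix.SpecialLinearGroup.coe_mul,
        eq_smul_one_of_fin_two h01 ha h11]
      simp
    exact mul_right_cancel (h.trans (hcentral _))
  have hentry := congrFun (congrFun (congrArg Subtype.val h.pairLongitude_commute.eq) 0) 1
  simp only [Matrix.SpecialLinearGroup.coe_mul, Matrix.mul_apply, Fin.sum_univ_two, h11] at hentry
  apply mul_left_cancel₀ h01
  linear_combination (pairLongitude n a c).1 0 0 * hentry +
    a.1 0 1 * upper_left_mul_lower_right hl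

end MatrixPairs

end ConwayKnot

section TwistRegion

variable {G : Type*} [Group G] {ε : ℤ} {g h : ℕ → G} {i K : ℕ}

theorem eq_conj_zpow_neg_iff {u v w : G} {e : ℤ} :
    u = MulAut.conj (w ^ (-e)) v ↔ v = MulAut.conj (w ^ e) u := by
  rw [zpow_neg, map_inv, MulAut.inv_apply, MulEquiv.eq_symm_apply, eq_comm]

/-- The relations at the crossing `i` of a twist region in which the two strands run in opposite
directions and all crossings have the sign `ε`. The edges of the strand that is the upper one at
the even crossings have the meridians `g 0, g 1, …`, those of the other strand have `h 0, h 1, …`;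
both are numbered in the direction of the first strand, so the second one runs from `h (i + 1)` to
`h i`. -/
def IsTwistAt (ε : ℤ) (g h : ℕ → G) (i : ℕ) : Prop :=
  if Even i then g (i + 1) = g i ∧ h (i + 1) = MulAut.conj (g i ^ ε) (h i)
  else h (i + 1) = h i ∧ g (i + 1) = MulAut.conj (h i ^ (-ε)) (g i)

theorem IsTwistAt.congr {g' h' : ℕ → G} (H : IsTwistAt ε g h i) (hg : g' i = g i) (hh : h' i = h i)
    (hg' : g' (i + 1) = g (i + 1)) (hh' : h' (i + 1) = h (i + 1)) : IsTwistAt ε g' h' i := by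
  rwa [IsTwistAt, hg, hh, hg', hh']

theorem IsTwistAt.succ_eq {g' h' : ℕ → G} (H : IsTwistAt ε g h i) (H' : IsTwistAt ε g' h' i)
    (hg : g i = g' i) (hh : h i = h' i) : g (i + 1) = g' (i + 1) ∧ h (i + 1) = h' (i + 1) := by
  unfold IsTwistAt at H H'
  split_ifs at H H'
  · exact ⟨by rw [H.1, H'.1, hg], by rw [H.2, H'.2, hg, hh]⟩
  · exact ⟨by rw [H.2, H'.2, hg, hh], by rw [H.1, H'.1, hh]⟩

theorem isTwistAt_conj_pow {r x y : G} (hy : MulAut.conj (x ^ ε) y = MulAut.conj r y)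
    (hx : MulAut.conj (MulAut.conj r y ^ (-ε)) x = MulAut.conj r x) (i : ℕ) :
    IsTwistAt ε (fun j ↦ MulAut.conj (r ^ (j / 2)) x)
      (fun j ↦ MulAut.conj (r ^ ((j + 1) / 2)) y) i := by
  have hconj (m : ℕ) (e : ℤ) (u v : G) : MulAut.conj (MulAut.conj (r ^ m) u ^ e)
      (MulAut.conj (r ^ m) v) = MulAut.conj (r ^ m) (MulAut.conj (u ^ e) v) := by
    rw [← map_zpow, MulAut.conj_apply (MulAut.conj (r ^ m) _), MulAut.conj_apply (_ ^ e), map_mul,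
      map_mul, map_inv]
  have hsucc (m : ℕ) (u : G) : MulAut.conj (r ^ (m + 1)) u =
      MulAut.conj (r ^ m) (MulAut.conj r u) := by
    rw [pow_succ, map_mul, MulAut.mul_apply]
  unfold IsTwistAt
  split_ifs with hi
  · obtain ⟨m, rfl⟩ := hi
    simp only [show (m + m) / 2 = m by lia, show (m + m + 1) / 2 = m by lia,
      show (m + m + 1 + 1) / 2 = m + 1 by lia, true_and]
    rw [hconj, hy, hsucc]
  · obtain ⟨m, rfl⟩ := Nat.not_even_iff_odd.1 hi
    simp only [show (2 * m + 1) / 2 = m by lia, show (2 * m + 1 + 1) / 2 = m + 1 by lia,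
      show (2 * m + 1 + 1 + 1) / 2 = m + 1 by lia, true_and]
    rw [hsucc, hsucc, hconj, hx]

theorem forall_isTwistAt_iff {r : G} (hh : MulAut.conj (g 0 ^ ε) (h 0) = MulAut.conj r (h 0))
    (hg : MulAut.conj (MulAut.conj r (h 0) ^ (-ε)) (g 0) = MulAut.conj r (g 0)) :
    (∀ i < K, IsTwistAt ε g h i) ↔ ∀ i ≤ K,
      g i = MulAut.conj (r ^ (i / 2)) (g 0) ∧ h i = MulAut.conj (r ^ ((i + 1) / 2)) (h 0) := by
  have hconj := isTwistAt_conj_pow hh hg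
  constructor
  · intro H i
    induction i with
    | zero => simp
    | succ i ih =>
      intro hi
      obtain ⟨hgi, hhi⟩ := ih (by lia)
      exact (H i (by lia)).succ_eq (hconj i) hgi hhi
  · intro H i hi
    exact (hconj i).congr (H i hi.le).1 (H i hi.le).2 (H (i + 1) hi).1 (H (i + 1) hi).2

end TwistRegion

namespace ConwayKnot

section Crossings

variable {n : ℤ} {c : Fin (k n + 4)}

/-- `1` or `-1`, according as the exponents in the first twist region go up to `n` or down
to `n`. -/
def twistDir (n : ℤ) : ℤ := if 0 < n then 1 else -1

theorem twistDir_mul_natAbs (n : ℤ) : twistDir n * n.natAbs = n := by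
  unfold twistDir; split_ifs <;> lia

theorem twistDir_mul_k (n : ℤ) : twistDir n * (k n : ℤ) = 2 * n := by
  rw [k, Nat.cast_mul, mul_left_comm, twistDir_mul_natAbs, Nat.cast_ofNat]

theorem even_k (n : ℤ) : Even (k n) := even_two_mul _

theorem sign_of_lt (hc : (c : ℕ) < k n) : ((knot n).sign c : ℤ) = -twistDir n := by
  unfold twistDir
  split_ifs with hn <;> simp [knot, hc, hn]

theorem sign_of_ge (hc : ¬(c : ℕ) < k n) : ((knot n).sign c : ℤ) = 1 := by
  simp [knot, hc]

theorem firstIsOver_of_lt (hc : (c : ℕ) < k n) : FirstIsOver n c ↔ (Even (c : ℕ) ↔ 0 < n) := by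
  simp [FirstIsOver, hc]

theorem firstIsOver_of_eq_add {j : ℕ} (hc : (c : ℕ) = k n + j) : FirstIsOver n c ↔ Even j := by
  simp [FirstIsOver, hc, Nat.even_add, even_k]

theorem secondPass_of_lt (hc : (c : ℕ) < k n) : secondPass n c = 2 * k n + 4 - (c + 1) := by
  rw [secondPass, if_pos hc]; lia

theorem secondPass_of_eq_add {j : ℕ} (hc : (c : ℕ) = k n + j) :
    secondPass n c = 2 * k n + 8 - (j + 1) := by
  rw [secondPass, if_neg (by lia)]; lia

theorem overPass_lt (n : ℤ) (c : Fin (k n + 4)) : overPass n c < 2 * k n + 8 := by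
  have := c.2
  unfold overPass firstPass secondPass; split_ifs <;> lia

theorem underPass_lt (n : ℤ) (c : Fin (k n + 4)) : underPass n c < 2 * k n + 8 := by
  have := c.2
  unfold underPass firstPass secondPass; split_ifs <;> lia

end Crossings

section Colorings

variable {G : Type*} [Group G] {n : ℤ} {c : Fin (k n + 4)} {x : ℕ → G}

/-- The Wirtinger relations at the crossing `c`, for edges with the meridians `x 0, x 1, …`. -/
def IsColoringAt (n : ℤ) (x : ℕ → G) (c : Fin (k n + 4)) : Prop :=
  x (overPass n c + 1) = x (overPass n c) ∧ x (underPass n c + 1) =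
    MulAut.conj (x (overPass n c) ^ (-((knot n).sign c : ℤ))) (x (underPass n c))

theorem isColoringAt_of_firstIsOver (hc : FirstIsOver n c) : IsColoringAt n x c ↔
    x (c + 1) = x c ∧ x (secondPass n c + 1) =
      MulAut.conj (x c ^ (-((knot n).sign c : ℤ))) (x (secondPass n c)) := by
  rw [IsColoringAt, overPass, underPass, if_pos hc, if_pos hc, firstPass]

theorem isColoringAt_of_not_firstIsOver (hc : ¬FirstIsOver n c) : IsColoringAt n x c ↔
    x (secondPass n c + 1) = x (secondPass n c) ∧ x (c + 1) =
      MulAut.conj (x (secondPass n c) ^ (-((knot n).sign c : ℤ))) (x c) := by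
  rw [IsColoringAt, overPass, underPass, if_neg hc, if_neg hc, firstPass]

theorem isColoringAt_iff_isTwistAt {g h : ℕ → G} {j : ℕ} (hc : FirstIsOver n c ↔ Even j)
    (hg : x c = g j) (hg' : x (c + 1) = g (j + 1)) (hh : x (secondPass n c + 1) = h j)
    (hh' : x (secondPass n c) = h (j + 1)) :
    IsColoringAt n x c ↔ IsTwistAt ((knot n).sign c : ℤ) g h j := by
  unfold IsTwistAt
  split_ifs with hj
  · rw [isColoringAt_of_firstIsOver (hc.2 hj), hg, hg', hh, hh', eq_conj_zpow_neg_iff]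
  · rw [isColoringAt_of_not_firstIsOver (mt hc.1 hj), hg, hg', hh, hh', eq_comm (a := h j)]
    exact and_congr_right fun h' ↦ by rw [h']

theorem isColoringAt_iff_isTwistAt_swap {g h : ℕ → G} {j : ℕ} (hc : FirstIsOver n c ↔ ¬Even j)
    (hg : x c = g j) (hg' : x (c + 1) = g (j + 1)) (hh : x (secondPass n c + 1) = h j)
    (hh' : x (secondPass n c) = h (j + 1)) :
    IsColoringAt n x c ↔ IsTwistAt (-((knot n).sign c : ℤ)) h g j := by
  unfold IsTwistAt
  split_ifs with hj
  · rw [isColoringAt_of_not_firstIsOver (mt hc.1 (not_not.2 hj)), hg, hg', hh, hh',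
      eq_comm (a := h j)]
    exact and_congr_right fun h' ↦ by rw [h']
  · rw [isColoringAt_of_firstIsOver (hc.2 hj), hg, hg', hh, hh', eq_conj_zpow_neg_iff, neg_neg]

theorem forall_isColoringAt_iff (n : ℤ) (x : ℕ → G) : (∀ c, IsColoringAt n x c) ↔
    (∀ i < k n, if 0 < n then IsTwistAt (-1) x (fun j ↦ x (2 * k n + 4 - j)) i
      else IsTwistAt (-1) (fun j ↦ x (2 * k n + 4 - j)) x i) ∧
    ∀ j < 4, IsTwistAt 1 (fun j ↦ x (k n + j)) (fun j ↦ x (2 * k n + 8 - j)) j := by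
  have hfirst {c : Fin (k n + 4)} (hc : (c : ℕ) < k n) : IsColoringAt n x c ↔
      if 0 < n then IsTwistAt (-1) x (fun j ↦ x (2 * k n + 4 - j)) c
        else IsTwistAt (-1) (fun j ↦ x (2 * k n + 4 - j)) x c := by
    have hsecond := secondPass_of_lt hc
    have hedge : secondPass n c + 1 = 2 * k n + 4 - c := by lia
    split_ifs with hn
    · rw [isColoringAt_iff_isTwistAt (h := fun j ↦ x (2 * k n + 4 - j))
        (by simp [firstIsOver_of_lt hc, hn]) rfl rfl
        (congrArg x hedge) (congrArg x hsecond), sign_of_lt hc, twistDir, if_pos hn]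
    · rw [isColoringAt_iff_isTwistAt_swap (h := fun j ↦ x (2 * k n + 4 - j))
        (by simp [firstIsOver_of_lt hc, hn]) rfl rfl
        (congrArg x hedge) (congrArg x hsecond), sign_of_lt hc, twistDir, if_neg hn, neg_neg]
  have hlast {c : Fin (k n + 4)} {j : ℕ} (hc : (c : ℕ) = k n + j) : IsColoringAt n x c ↔
      IsTwistAt 1 (fun j ↦ x (k n + j)) (fun j ↦ x (2 * k n + 8 - j)) j := by
    have hsecond := secondPass_of_eq_add hc
    have hedge : secondPass n c + 1 = 2 * k n + 8 - j := by lia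
    rw [isColoringAt_iff_isTwistAt (g := fun j ↦ x (k n + j))
      (h := fun j ↦ x (2 * k n + 8 - j)) (firstIsOver_of_eq_add hc) (congrArg x hc)
      (by rw [hc, add_assoc]) (congrArg x hedge) (congrArg x hsecond), sign_of_ge (by lia)]
  constructor
  · exact fun H ↦ ⟨fun i hi ↦ (hfirst (c := ⟨i, by lia⟩) hi).1 (H _),
      fun j hj ↦ (hlast (c := ⟨k n + j, by lia⟩) rfl).1 (H _)⟩
  · rintro ⟨H, H'⟩ c
    by_cases hc : (c : ℕ) < k n
    · exact (hfirst hc).2 (H c hc)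
    · exact (hlast (j := c - k n) (by lia)).2 (H' _ (by lia))

end Colorings

section Arcs

variable {G : Type*} [Group G] {n : ℤ} {a c : G} {x : ℕ → G}

/-- The meridians of the edges in terms of those of the edges `0` and `k n`, on the four arcs in
which the knot runs through the twist regions. The second pass through a region is numbered
backwards, so that equal indices belong to edges at the same place of the region. -/
structure ArcFormulas (n : ℤ) (a c : G) (x : ℕ → G) : Prop where
  first : ∀ i ≤ k n, x i = MulAut.conj (twistR a c ^ (twistDir n * i / 2)) a
  second : ∀ j ≤ 4, x (k n + j) = MulAut.conj (twistS a c ^ (j / 2)) c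
  third : ∀ i ≤ k n, x (2 * k n + 4 - i) =
    MulAut.conj (twistR a c ^ ((twistDir n * i + 1) / 2)) (a * twistR a c)
  fourth : ∀ j ≤ 4, x (2 * k n + 8 - j) = MulAut.conj (twistS a c ^ ((j + 1) / 2)) a

theorem knotRelation_iff_conj : KnotRelation n a c ↔ MulAut.conj (twistR a c ^ n) a = c := by
  rw [KnotRelation, MulAut.conj_apply, mul_inv_eq_iff_eq_mul, eq_comm]

theorem KnotRelation.conj_mul_twistR (h : KnotRelation n a c) :
    MulAut.conj (twistR a c ^ n) (a * twistR a c) = MulAut.conj (twistS a c ^ 2) c := by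
  rw [map_mul, knotRelation_iff_conj.1 h, MulAut.conj_apply (twistS a c ^ 2), ← mul_twistR,
    MulAut.conj_apply, (Commute.zpow_self _ n).eq, mul_inv_cancel_right]

theorem ArcFormulas.knotRelation (H : ArcFormulas n a c x) : KnotRelation n a c := by
  have hfirst := H.first (k n) le_rfl
  have hsecond := H.second 0 (Nat.zero_le 4)
  rw [twistDir_mul_k, Int.mul_ediv_cancel_left n two_ne_zero] at hfirst
  rw [Nat.zero_div, pow_zero, map_one, MulAut.one_apply, add_zero] at hsecond
  exact knotRelation_iff_conj.2 (hfirst.symm.trans hsecond)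

theorem forall_isTwistAt_first_iff (hx : x 0 = a) (hx' : x (2 * k n + 4) = a * twistR a c) :
    (∀ i < k n, if 0 < n then IsTwistAt (-1) x (fun j ↦ x (2 * k n + 4 - j)) i
      else IsTwistAt (-1) (fun j ↦ x (2 * k n + 4 - j)) x i) ↔
    ∀ i ≤ k n, x i = MulAut.conj (twistR a c ^ (twistDir n * i / 2)) a ∧
      x (2 * k n + 4 - i) =
        MulAut.conj (twistR a c ^ ((twistDir n * i + 1) / 2)) (a * twistR a c) := by
  unfold twistDir
  split_ifs with hn
  · rw [forall_isTwistAt_iff (r := twistR a c)]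
    · simp only [tsub_zero, hx, hx', one_mul, ← zpow_natCast, Nat.cast_add, Int.natCast_ediv,
        Nat.cast_one, Nat.cast_ofNat]
    all_goals
      simp only [tsub_zero, hx, hx', MulAut.conj_apply]
      group
  · rw [forall_isTwistAt_iff (r := (twistR a c)⁻¹)]
    · have hfloor (i : ℕ) : (-1 * i : ℤ) / 2 = -(((i + 1) / 2 : ℕ) : ℤ) := by lia
      have hceil (i : ℕ) : (-1 * i + 1 : ℤ) / 2 = -((i / 2 : ℕ) : ℤ) := by lia
      simp only [tsub_zero, hx, hx', hfloor, hceil, inv_pow, zpow_neg, zpow_natCast]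
      exact forall₂_congr fun _ _ ↦ and_comm
    all_goals
      simp only [tsub_zero, hx, hx', MulAut.conj_apply]
      group

theorem forall_isTwistAt_second_iff (hx : x (k n) = c) (hx' : x (2 * k n + 8) = a) :
    (∀ j < 4, IsTwistAt 1 (fun j ↦ x (k n + j)) (fun j ↦ x (2 * k n + 8 - j)) j) ↔
    ∀ j ≤ 4, x (k n + j) = MulAut.conj (twistS a c ^ (j / 2)) c ∧
      x (2 * k n + 8 - j) = MulAut.conj (twistS a c ^ ((j + 1) / 2)) a := by
  rw [forall_isTwistAt_iff (r := twistS a c)]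
  · simp only [tsub_zero, add_zero, hx, hx']
  all_goals
    simp only [tsub_zero, add_zero, hx, hx', MulAut.conj_apply, twistS]
    group

theorem arcFormulas_of_isColoringAt (hx : x (2 * k n + 8) = x 0) (H : ∀ d, IsColoringAt n x d) :
    ArcFormulas n (x 0) (x (k n)) x := by
  obtain ⟨hfirst, hsecond⟩ := (forall_isColoringAt_iff n x).1 H
  rw [forall_isTwistAt_second_iff rfl hx] at hsecond
  have hx' : x (2 * k n + 4) = x 0 * twistR (x 0) (x (k n)) := by
    rw [← twistS_sq_conj]
    exact (hsecond 4 le_rfl).2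
  rw [forall_isTwistAt_first_iff rfl hx'] at hfirst
  exact ⟨fun i hi ↦ (hfirst i hi).1, fun j hj ↦ (hsecond j hj).1,
    fun i hi ↦ (hfirst i hi).2, fun j hj ↦ (hsecond j hj).2⟩

theorem ArcFormulas.zero (H : ArcFormulas n a c x) : x 0 = a := by
  simpa using H.first 0 (Nat.zero_le _)

theorem ArcFormulas.k (H : ArcFormulas n a c x) : x (k n) = c := by
  simpa using H.second 0 (Nat.zero_le 4)

theorem ArcFormulas.last (H : ArcFormulas n a c x) : x (2 * ConwayKnot.k n + 8) = a := by
  simpa using H.fourth 0 (Nat.zero_le 4)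

theorem ArcFormulas.isColoringAt (H : ArcFormulas n a c x) : ∀ d, IsColoringAt n x d := by
  rw [forall_isColoringAt_iff, forall_isTwistAt_second_iff H.k H.last,
    forall_isTwistAt_first_iff H.zero (by simpa using H.third 0 (Nat.zero_le _))]
  exact ⟨fun i hi ↦ ⟨H.first i hi, H.third i hi⟩, fun j hj ↦ ⟨H.second j hj, H.fourth j hj⟩⟩

/-- The meridians of the edges as words in those of the edges `0` and `k n`. -/
def edgeWord (n : ℤ) (a c : G) (i : ℕ) : G :=
  if i < k n then MulAut.conj (twistR a c ^ (twistDir n * i / 2)) a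
  else if i < k n + 4 then MulAut.conj (twistS a c ^ ((i - k n) / 2)) c
  else if i < 2 * k n + 4 then
    MulAut.conj (twistR a c ^ ((twistDir n * (2 * k n + 4 - i : ℕ) + 1) / 2)) (a * twistR a c)
  else MulAut.conj (twistS a c ^ ((2 * k n + 8 - i + 1) / 2)) a

theorem KnotRelation.arcFormulas_edgeWord (h : KnotRelation n a c) :
    ArcFormulas n a c (edgeWord n a c) where
  first i hi := by
    unfold edgeWord
    rcases hi.lt_or_eq with hi | rfl
    · rw [if_pos hi]
    · rw [if_neg (lt_irrefl _), if_pos (by lia), Nat.sub_self, Nat.zero_div, pow_zero, map_one,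
        MulAut.one_apply, twistDir_mul_k, Int.mul_ediv_cancel_left n two_ne_zero,
        knotRelation_iff_conj.1 h]
  second j hj := by
    unfold edgeWord
    rw [if_neg (by lia)]
    rcases hj.lt_or_eq with hj | rfl
    · rw [if_pos (by lia), Nat.add_sub_cancel_left]
    · rw [if_neg (lt_irrefl _)]
      split_ifs with hk
      · rw [show 2 * k n + 4 - (k n + 4) = k n by lia, twistDir_mul_k,
          show (2 * n + 1) / 2 = n by lia, h.conj_mul_twistR]
      · have hk' : k n = 0 := by lia
        have hn : n = 0 := by unfold k at hk'; lia
        subst hn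
        have hca : c = a := by simpa [KnotRelation] using h
        rw [hk', hca]
  third i hi := by
    unfold edgeWord
    rw [if_neg (by lia), if_neg (by lia)]
    rcases Nat.eq_zero_or_pos i with rfl | hpos
    · rw [if_neg (by lia), show (2 * k n + 8 - (2 * k n + 4 - 0) + 1) / 2 = 2 by lia,
        MulAut.conj_apply, twistS_sq_conj]
      simp
    · rw [if_pos (by lia), show 2 * k n + 4 - (2 * k n + 4 - i) = i by lia]
  fourth j hj := by
    unfold edgeWord
    rw [if_neg (by lia), if_neg (by lia), if_neg (by lia),
      show 2 * k n + 8 - (2 * k n + 8 - j) = j by lia]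

end Arcs

section KnotGroup

variable {G : Type*} [Group G] {n : ℤ} {a c : G}

theorem knot_overAt (n : ℤ) (d : Fin (k n + 4)) : (knot n).overAt d = (overPass n d : ℕ) := rfl

theorem knot_underAt (n : ℤ) (d : Fin (k n + 4)) : (knot n).underAt d = (underPass n d : ℕ) := rfl

theorem lift_wirtingerRels_eq_one {f : ZMod (2 * (knot n).crossings) → G}
    (H : ∀ d, IsColoringAt n (fun i ↦ f i) d) :
    ∀ r ∈ (knot n).wirtingerRels, FreeGroup.lift f r = 1 := by
  rintro r ⟨d, rfl | rfl⟩
  · rw [knot_overAt n d, ← Nat.cast_add_one, map_mul, map_inv, FreeGroup.lift_apply_of,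
      FreeGroup.lift_apply_of, inv_mul_eq_one]
    exact (H d).1
  · rw [knot_overAt n d, knot_underAt n d, ← Nat.cast_add_one]
    simp only [map_mul, map_inv, map_zpow, FreeGroup.lift_apply_of]
    exact inv_mul_eq_one.2 ((H d).2.trans (by rw [MulAut.conj_apply, ← zpow_neg, neg_neg]))

theorem val_natCast_congr {α : Type*} {x : ℕ → α} (hx : x (2 * k n + 8) = x 0) {i : ℕ}
    (hi : i ≤ 2 * k n + 8) : x ((i : ZMod (2 * (k n + 4))).val) = x i := by
  rw [ZMod.val_natCast]
  rcases hi.lt_or_eq with h | rfl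
  · rw [Nat.mod_eq_of_lt (by lia)]
  · rw [hx, show 2 * (k n + 4) = 2 * k n + 8 by ring, Nat.mod_self]

/-- The meridian of the edge `i`, indexed by natural numbers. -/
def edge (n : ℤ) (i : ℕ) : (knot n).knotGroup := (knot n).edgeMeridian (i : ZMod (2 * (k n + 4)))

theorem meridian_eq (n : ℤ) : (knot n).meridian = edge n 0 := by
  rw [edge, Nat.cast_zero]; rfl

theorem KnotRelation.exists_hom (h : KnotRelation n a c) :
    ∃ ρ : (knot n).knotGroup →* G, ρ (edge n 0) = a ∧ ρ (edge n (k n)) = c := by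
  have harc := h.arcFormulas_edgeWord
  let f : ZMod (2 * (knot n).crossings) → G :=
    fun z ↦ edgeWord n a c (ZMod.val (n := 2 * (k n + 4)) z)
  have hf {i : ℕ} (hi : i ≤ 2 * k n + 8) : f (i : ℕ) = edgeWord n a c i :=
    val_natCast_congr (harc.last.trans harc.zero.symm) hi
  have hcol (d : Fin (k n + 4)) : IsColoringAt n (fun i ↦ f i) d := by
    have hover := overPass_lt n d
    have hunder := underPass_lt n d
    rw [IsColoringAt, hf hover, hf hover.le, hf hunder, hf hunder.le]
    exact harc.isColoringAt d
  have hrels := lift_wirtingerRels_eq_one hcol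
  have hof (i : ℕ) : PresentedGroup.toGroup hrels (edge n i) = f i :=
    PresentedGroup.toGroup.of hrels
  exact ⟨PresentedGroup.toGroup hrels, by rw [hof, hf (by lia), harc.zero],
    by rw [hof, hf (by lia), harc.k]⟩

theorem edge_isColoringAt (n : ℤ) (d : Fin (k n + 4)) : IsColoringAt n (edge n) d := by
  constructor
  · have h := PresentedGroup.one_of_mem (rels := (knot n).wirtingerRels) ⟨d, Or.inl rfl⟩
    rw [knot_overAt, ← Nat.cast_add_one, map_mul, map_inv, inv_mul_eq_one] at h
    exact h
  · have h := PresentedGroup.one_of_mem (rels := (knot n).wirtingerRels) ⟨d, Or.inr rfl⟩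
    rw [knot_overAt, knot_underAt, ← Nat.cast_add_one, map_mul, map_inv, inv_mul_eq_one, map_mul,
      map_mul, map_zpow, map_zpow] at h
    rw [MulAut.conj_apply, ← zpow_neg, neg_neg]
    exact h

theorem edge_arcFormulas (n : ℤ) : ArcFormulas n (edge n 0) (edge n (k n)) (edge n) := by
  refine arcFormulas_of_isColoringAt ?_ (edge_isColoringAt n)
  rw [edge, edge, show 2 * k n + 8 = 2 * (k n + 4) by ring, ZMod.natCast_self, Nat.cast_zero]

theorem edge_knotRelation (n : ℤ) : KnotRelation n (edge n 0) (edge n (k n)) :=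
  (edge_arcFormulas n).knotRelation

theorem ArcFormulas.mem_closure {x : ℕ → G} (H : ArcFormulas n a c x) {i : ℕ}
    (hi : i ≤ 2 * ConwayKnot.k n + 8) : x i ∈ Subgroup.closure {a, c} := by
  set P := Subgroup.closure {a, c}
  have ha : a ∈ P := Subgroup.subset_closure (by simp)
  have hc : c ∈ P := Subgroup.subset_closure (by simp)
  have hs : twistS a c ∈ P := P.mul_mem hc (P.inv_mem ha)
  have hr : twistR a c ∈ P :=
    P.mul_mem (P.mul_mem (P.mul_mem (P.inv_mem ha) (P.pow_mem hs 2)) ha)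
      (P.inv_mem (P.pow_mem hs 2))
  have hconj {g y : G} (hg : g ∈ P) (hy : y ∈ P) : MulAut.conj g y ∈ P :=
    P.mul_mem (P.mul_mem hg hy) (P.inv_mem hg)
  have hcases : i ≤ ConwayKnot.k n ∨ (∃ j ≤ 4, i = ConwayKnot.k n + j) ∨
      (∃ j ≤ ConwayKnot.k n, i = 2 * ConwayKnot.k n + 4 - j) ∨
      ∃ j ≤ 4, i = 2 * ConwayKnot.k n + 8 - j := by
    rcases le_or_gt i (ConwayKnot.k n) with h₁ | h₁
    · exact Or.inl h₁
    rcases le_or_gt i (ConwayKnot.k n + 4) with h₂ | h₂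
    · exact Or.inr (Or.inl ⟨i - ConwayKnot.k n, by lia, by lia⟩)
    rcases le_or_gt i (2 * ConwayKnot.k n + 4) with h₃ | h₃
    · exact Or.inr (Or.inr (Or.inl ⟨2 * ConwayKnot.k n + 4 - i, by lia, by lia⟩))
    · exact Or.inr (Or.inr (Or.inr ⟨2 * ConwayKnot.k n + 8 - i, by lia, by lia⟩))
  rcases hcases with hi | ⟨j, hj, rfl⟩ | ⟨j, hj, rfl⟩ | ⟨j, hj, rfl⟩
  · exact H.first i hi ▸ hconj (P.zpow_mem hr _) ha
  · exact H.second j hj ▸ hconj (P.pow_mem hs _) hc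
  · exact H.third j hj ▸ hconj (P.zpow_mem hr _) (P.mul_mem ha hr)
  · exact H.fourth j hj ▸ hconj (P.pow_mem hs _) ha

theorem closure_edges (n : ℤ) : Subgroup.closure {edge n 0, edge n (k n)} = ⊤ := by
  rw [eq_top_iff, ← PresentedGroup.closure_range_of, Subgroup.closure_le]
  rintro _ ⟨z, rfl⟩
  have hz : PresentedGroup.of z = edge n (ZMod.val (n := 2 * (k n + 4)) z) :=
    congrArg PresentedGroup.of (ZMod.natCast_zmod_val (n := 2 * (k n + 4)) z).symm
  have hlt : ZMod.val (n := 2 * (k n + 4)) z < 2 * (k n + 4) := ZMod.val_lt _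
  rw [hz]
  exact (edge_arcFormulas n).mem_closure (by lia)

end KnotGroup

end ConwayKnot

namespace SignedGaussCode

theorem passFactor_overAt (D : SignedGaussCode) (d : Fin D.crossings) :
    D.passFactor (D.overAt d) = 1 := by
  have h : (Equiv.ofBijective _ D.passes).symm (D.overAt d) = Sum.inl d :=
    (Equiv.symm_apply_eq _).2 rfl
  rw [passFactor, h]

theorem passFactor_underAt (D : SignedGaussCode) (d : Fin D.crossings) :
    D.passFactor (D.underAt d) = D.edgeMeridian (D.overAt d) ^ (D.sign d : ℤ) := by
  have h : (Equiv.ofBijective _ D.passes).symm (D.underAt d) = Sum.inr d :=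
    (Equiv.symm_apply_eq _).2 rfl
  rw [passFactor, h]

end SignedGaussCode

namespace ConwayKnot

section Longitude

variable {n : ℤ} {j : ℕ}

theorem writhe_eq (n : ℤ) : (knot n).writhe = 4 - 2 * n := by
  have hfirst (i : Fin (k n)) : ((knot n).sign (Fin.castAdd 4 i) : ℤ) = -twistDir n :=
    sign_of_lt i.2
  have hsecond (i : Fin 4) : ((knot n).sign (Fin.natAdd (k n) i) : ℤ) = 1 := sign_of_ge (by simp)
  calc (knot n).writhe = ∑ c : Fin (k n + 4), ((knot n).sign c : ℤ) := rfl
    _ = k n * -twistDir n + 4 := by simp [Fin.sum_univ_add, hfirst, hsecond]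
    _ = 4 - 2 * n := by rw [← twistDir_mul_k]; ring

/-- The contribution of the pass `i` to the longitude, indexed by natural numbers. -/
def factor (n : ℤ) (i : ℕ) : (knot n).knotGroup := (knot n).passFactor (i : ZMod (2 * (k n + 4)))

theorem factor_overPass (n : ℤ) (c : Fin (k n + 4)) : factor n (overPass n c) = 1 :=
  (knot n).passFactor_overAt c

theorem factor_underPass (n : ℤ) (c : Fin (k n + 4)) :
    factor n (underPass n c) = edge n (overPass n c) ^ ((knot n).sign c : ℤ) :=
  (knot n).passFactor_underAt c

theorem factor_of_firstIsOver {c : Fin (k n + 4)} (hc : FirstIsOver n c) :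
    factor n c = 1 ∧ factor n (secondPass n c) = edge n c ^ ((knot n).sign c : ℤ) := by
  have hover := factor_overPass n c
  have hunder := factor_underPass n c
  rw [underPass, if_pos hc] at hunder
  rw [overPass, if_pos hc] at hover hunder
  exact ⟨hover, hunder⟩

theorem factor_of_not_firstIsOver {c : Fin (k n + 4)} (hc : ¬FirstIsOver n c) :
    factor n c = edge n (secondPass n c) ^ ((knot n).sign c : ℤ) ∧
      factor n (secondPass n c) = 1 := by
  have hover := factor_overPass n c
  have hunder := factor_underPass n c
  rw [underPass, if_neg hc] at hunder
  rw [overPass, if_neg hc] at hover hunder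
  exact ⟨hunder, hover⟩

theorem factor_of_lt_of_even_iff {i : ℕ} (hi : i < k n) (h : Even i ↔ 0 < n) :
    factor n i = 1 ∧ factor n (2 * k n + 4 - (i + 1)) = edge n i ^ (-twistDir n) := by
  let c : Fin (k n + 4) := ⟨i, by lia⟩
  have hc : (c : ℕ) < k n := hi
  rw [← sign_of_lt hc, ← secondPass_of_lt hc]
  exact factor_of_firstIsOver ((firstIsOver_of_lt hc).2 h)

theorem factor_of_lt_of_not_even_iff {i : ℕ} (hi : i < k n) (h : ¬(Even i ↔ 0 < n)) :
    factor n i = edge n (2 * k n + 4 - (i + 1)) ^ (-twistDir n) ∧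
      factor n (2 * k n + 4 - (i + 1)) = 1 := by
  let c : Fin (k n + 4) := ⟨i, by lia⟩
  have hc : (c : ℕ) < k n := hi
  rw [← sign_of_lt hc, ← secondPass_of_lt hc]
  exact factor_of_not_firstIsOver (mt (firstIsOver_of_lt hc).1 h)

theorem factor_add_of_even (n : ℤ) (hj : j < 4) (h : Even j) :
    factor n (k n + j) = 1 ∧ factor n (2 * k n + 8 - (j + 1)) = edge n (k n + j) := by
  let c : Fin (k n + 4) := ⟨k n + j, by lia⟩
  have hc : (c : ℕ) = k n + j := rfl
  have hfactor := factor_of_firstIsOver ((firstIsOver_of_eq_add hc).2 h)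
  rwa [sign_of_ge (by lia), zpow_one, secondPass_of_eq_add hc] at hfactor

theorem factor_add_of_not_even (n : ℤ) (hj : j < 4) (h : ¬Even j) :
    factor n (k n + j) = edge n (2 * k n + 8 - (j + 1)) ∧
      factor n (2 * k n + 8 - (j + 1)) = 1 := by
  let c : Fin (k n + 4) := ⟨k n + j, by lia⟩
  have hc : (c : ℕ) = k n + j := rfl
  have hfactor := factor_of_not_firstIsOver (mt (firstIsOver_of_eq_add hc).1 h)
  rwa [sign_of_ge (by lia), zpow_one, secondPass_of_eq_add hc] at hfactor

/-- The contribution of the first `m` passes to the longitude. -/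
def partialLongitude (n : ℤ) (m : ℕ) : (knot n).knotGroup := ((List.range m).map (factor n)).prod

theorem partialLongitude_succ (n : ℤ) (m : ℕ) :
    partialLongitude n (m + 1) = partialLongitude n m * factor n m := by
  simp [partialLongitude, List.range_succ]

theorem partialLongitude_add_two_mul {p m : ℕ} {t : ℕ → (knot n).knotGroup}
    {w : (knot n).knotGroup}
    (h : ∀ j < m, factor n (p + 2 * j) * factor n (p + 2 * j + 1) = t j * w * (t (j + 1))⁻¹) :
    partialLongitude n (p + 2 * m) = partialLongitude n p * (t 0 * w ^ m * (t m)⁻¹) := by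
  induction m with
  | zero => simp
  | succ m ih =>
    rw [show p + 2 * (m + 1) = p + 2 * m + 1 + 1 by ring, partialLongitude_succ,
      partialLongitude_succ, ih fun j hj ↦ h j (by lia), mul_assoc, mul_assoc, h m (by lia),
      pow_succ]
    group

theorem factor_mul_factor_first (hj : j < n.natAbs) :
    factor n (2 * j) * factor n (2 * j + 1) =
      twistR (edge n 0) (edge n (k n)) ^ (twistDir n * j) * edge n 0 ^ (-twistDir n) *
        (twistR (edge n 0) (edge n (k n)) ^ (twistDir n * (j + 1 : ℕ)))⁻¹ := by
  have harc := (edge_arcFormulas n).third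
  have hk : k n = 2 * n.natAbs := rfl
  by_cases hn : 0 < n
  · have hdir : twistDir n = 1 := if_pos hn
    rw [(factor_of_lt_of_even_iff (by lia) (by simp [hn])).1,
      (factor_of_lt_of_not_even_iff (by lia) (by simp [hn])).1, harc _ (by lia), hdir,
      show (1 * (2 * j + 1 + 1 : ℕ) + 1 : ℤ) / 2 = j + 1 by lia, MulAut.conj_apply, Nat.cast_succ]
    group
  · have hdir : twistDir n = -1 := if_neg hn
    rw [(factor_of_lt_of_not_even_iff (by lia) (by simp [hn])).1,
      (factor_of_lt_of_even_iff (by lia) (by simp [hn])).1, harc _ (by lia), hdir,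
      show (-1 * (2 * j + 1 : ℕ) + 1 : ℤ) / 2 = -j by lia, MulAut.conj_apply, Nat.cast_succ]
    group

theorem factor_mul_factor_third (hj : j < n.natAbs) :
    factor n (k n + 4 + 2 * j) * factor n (k n + 4 + 2 * j + 1) =
      twistR (edge n 0) (edge n (k n)) ^ (twistDir n * (n.natAbs - j : ℕ)) *
        (edge n 0 * twistR (edge n 0) (edge n (k n))) ^ (-twistDir n) *
        (twistR (edge n 0) (edge n (k n)) ^ (twistDir n * (n.natAbs - (j + 1) : ℕ)))⁻¹ := by
  have harc := (edge_arcFormulas n).first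
  have hk : k n = 2 * n.natAbs := rfl
  obtain ⟨l, hl⟩ := Nat.exists_eq_add_of_lt hj
  rw [show n.natAbs - j = l + 1 by lia, show n.natAbs - (j + 1) = l by lia,
    show k n + 4 + 2 * j = 2 * k n + 4 - (2 * l + 1 + 1) by lia,
    show 2 * k n + 4 - (2 * l + 1 + 1) + 1 = 2 * k n + 4 - (2 * l + 1) by lia]
  by_cases hn : 0 < n
  · have hdir : twistDir n = 1 := if_pos hn
    rw [(factor_of_lt_of_not_even_iff (by lia) (by simp [hn])).2,
      (factor_of_lt_of_even_iff (by lia) (by simp [hn])).2, harc _ (by lia), hdir,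
      show (1 * (2 * l : ℕ) : ℤ) / 2 = l by lia, MulAut.conj_apply, Nat.cast_succ]
    group
  · have hdir : twistDir n = -1 := if_neg hn
    rw [(factor_of_lt_of_even_iff (by lia) (by simp [hn])).2,
      (factor_of_lt_of_not_even_iff (by lia) (by simp [hn])).2, harc _ (by lia), hdir,
      show (-1 * (2 * l + 1 : ℕ) : ℤ) / 2 = -l - 1 by lia, MulAut.conj_apply, Nat.cast_succ]
    group

theorem partialLongitude_first (n : ℤ) : partialLongitude n (k n) =
    edge n 0 ^ (-n) * (twistR (edge n 0) (edge n (k n)) ^ n)⁻¹ := by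
  have h := partialLongitude_add_two_mul (p := 0) (m := n.natAbs) fun j hj ↦ by
    simpa only [zero_add] using factor_mul_factor_first hj
  rw [zero_add] at h
  rw [show k n = 2 * n.natAbs from rfl] at h ⊢
  rw [h, twistDir_mul_natAbs, ← zpow_natCast, ← zpow_mul, neg_mul, twistDir_mul_natAbs]
  simp [partialLongitude]

theorem partialLongitude_second (n : ℤ) : partialLongitude n (k n + 4) = partialLongitude n (k n) *
    (edge n (k n) ^ 2 * (twistS (edge n 0) (edge n (k n)) ^ 2)⁻¹) := by
  have h := partialLongitude_add_two_mul (n := n) (p := k n) (m := 2)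
    (t := fun j ↦ twistS (edge n 0) (edge n (k n)) ^ j) (w := edge n (k n)) fun j hj ↦ by
    rw [(factor_add_of_even n (by lia) (by simp)).1, add_assoc,
      (factor_add_of_not_even n (by lia) (by simp)).1, (edge_arcFormulas n).fourth _ (by lia),
      show (2 * j + 1 + 1 + 1) / 2 = j + 1 by lia, MulAut.conj_apply, pow_succ, twistS]
    group
  simpa using h

theorem partialLongitude_third (n : ℤ) : partialLongitude n (2 * k n + 4) =
    partialLongitude n (k n + 4) * (twistR (edge n 0) (edge n (k n)) ^ n *
      (edge n 0 * twistR (edge n 0) (edge n (k n))) ^ (-n)) := by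
  have h := partialLongitude_add_two_mul (p := k n + 4) (m := n.natAbs)
    (t := fun j ↦ twistR (edge n 0) (edge n (k n)) ^ (twistDir n * (n.natAbs - j : ℕ)))
    fun j hj ↦ factor_mul_factor_third hj
  rw [show k n + 4 + 2 * n.natAbs = 2 * k n + 4 by unfold k; lia, ← zpow_natCast, ← zpow_mul,
    neg_mul, Nat.sub_zero, Nat.sub_self, twistDir_mul_natAbs] at h
  simpa using h

theorem partialLongitude_fourth (n : ℤ) : partialLongitude n (2 * k n + 8) =
    partialLongitude n (2 * k n + 4) *
      (twistS (edge n 0) (edge n (k n)) ^ 2 * edge n 0 ^ 2) := by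
  have h := partialLongitude_add_two_mul (n := n) (p := 2 * k n + 4) (m := 2)
    (t := fun j ↦ twistS (edge n 0) (edge n (k n)) ^ (2 - j)) (w := edge n 0) fun j hj ↦ by
    obtain ⟨l, hl⟩ := Nat.exists_eq_add_of_lt hj
    rw [show 2 * k n + 4 + 2 * j = 2 * k n + 8 - (2 * l + 1 + 1) by lia,
      show 2 * k n + 8 - (2 * l + 1 + 1) + 1 = 2 * k n + 8 - (2 * l + 1) by lia,
      show 2 - j = l + 1 by lia, show 2 - (j + 1) = l by lia,
      (factor_add_of_not_even n (by lia) (by simp)).2,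
      (factor_add_of_even n (by lia) (by simp)).2, (edge_arcFormulas n).second _ (by lia),
      show 2 * l / 2 = l by lia, MulAut.conj_apply, pow_succ, twistS]
    group
  simpa using h

theorem longitude_eq (n : ℤ) :
    (knot n).longitude = pairLongitude n (edge n 0) (edge n (k n)) := by
  have hrel := edge_knotRelation n
  have hcomm := hrel.pairLongitude_commute
  have hconj := twistS_sq_conj (edge n 0) (edge n (k n))
  have hlongitude : (knot n).longitude =
      partialLongitude n (2 * k n + 8) * edge n 0 ^ (-(4 - 2 * n)) := by
    rw [← writhe_eq, ← meridian_eq]; rfl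
  rw [hlongitude, partialLongitude_fourth, partialLongitude_third, partialLongitude_second,
    partialLongitude_first]
  rw [KnotRelation] at hrel
  unfold pairLongitude at hcomm ⊢
  generalize twistR (edge n 0) (edge n (k n)) = r at *
  generalize twistS (edge n 0) (edge n (k n)) ^ 2 = s at *
  generalize edge n 0 = a at *
  generalize edge n (k n) = c at *
  have hc : (r ^ n)⁻¹ * c ^ 2 = a ^ 2 * (r ^ n)⁻¹ := by
    rw [eq_mul_inv_of_mul_eq hrel, conj_pow]; group
  have hs : (a * r) ^ (-n) * s = s * a ^ (-n) := by
    rw [← hconj, conj_zpow]; group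
  calc _ = a ^ (-n) * ((r ^ n)⁻¹ * c ^ 2) * s⁻¹ * r ^ n * ((a * r) ^ (-n) * s) * a ^ 2 *
        a ^ (-(4 - 2 * n)) := by group
    _ = a ^ (2 - n) * ((r ^ n)⁻¹ * s⁻¹ * r ^ n * s) * a ^ (n - 2) := by rw [hc, hs]; group
    _ = (r ^ n)⁻¹ * s⁻¹ * r ^ n * s := by
      rw [← (hcomm.zpow_right (2 - n)).eq]; group

end Longitude

end ConwayKnot

section IrreducibleFactors

variable {K : Type*} [Field K] {F P B : MvPolynomial (Fin 2) K}

theorem irreducible_X_sub_C (i : Fin 2) (ζ : K) :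
    Irreducible (X i - C ζ : MvPolynomial (Fin 2) K) := by
  have h := irreducible_mul_X_add (1 : MvPolynomial (Fin 2) K) (C (-ζ)) i one_ne_zero (by simp)
    (by simp) isRelPrime_one_left
  rwa [one_mul, map_neg, ← sub_eq_add_neg] at h

theorem irreducible_X_mul_X_sq_add_one :
    Irreducible (X 0 * X 1 ^ 2 + 1 : MvPolynomial (Fin 2) K) := by
  have h := irreducible_mul_X_add (X 1 ^ 2 : MvPolynomial (Fin 2) K) 1 0 (by simp)
    (fun h ↦ by simpa using vars_pow _ _ h) (by simp) isRelPrime_one_right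
  rwa [mul_comm] at h

theorem not_dvd_of_eval_ne_zero (hF : Irreducible F) (hFB : F ∣ B) (hP : Irreducible P)
    {v : Fin 2 → K} (hv : eval v P = 0) (hB : eval v B ≠ 0) : ¬F ∣ P := by
  intro hFP
  obtain ⟨D, rfl⟩ := (hF.associated_of_dvd hP hFP).symm.dvd.trans hFB
  rw [map_mul, hv, zero_mul] at hB
  exact hB rfl

theorem not_dvd_X_sq_sub_C [IsAlgClosed K] (hF : Irreducible F) (hFB : F ∣ B) {i : Fin 2} {m : K}
    (h : ∀ ζ, ζ ^ 2 = m → ∃ v : Fin 2 → K, v i = ζ ∧ eval v B ≠ 0) : ¬F ∣ X i ^ 2 - C m := by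
  have hline (ζ : K) (hζ : ζ ^ 2 = m) : ¬F ∣ X i - C ζ := by
    obtain ⟨v, rfl, hv⟩ := h ζ hζ
    exact not_dvd_of_eval_ne_zero hF hFB (irreducible_X_sub_C i _) (by simp) hv
  obtain ⟨ζ, hζ⟩ := IsAlgClosed.exists_pow_nat_eq m (n := 2) two_pos
  have hfactor : X i ^ 2 - C m = (X i - C ζ) * (X i - C (-ζ)) := by
    rw [← hζ, map_pow, map_neg]; ring
  rw [hfactor, hF.prime.dvd_mul, not_or]
  exact ⟨hline ζ hζ, hline (-ζ) (by rw [neg_sq, hζ])⟩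

end IrreducibleFactors

namespace ConwayKnot

section EigenvaluePairs

open scoped MatrixGroups commutatorElement

variable {n : ℤ} {v : Fin 2 → ℂ}

theorem commute_of_map_edges_eq {G : Type*} [Group G] (ρ : (knot n).knotGroup →* G)
    (h : ρ (edge n (k n)) = ρ (edge n 0)) (g₁ g₂ : (knot n).knotGroup) :
    Commute (ρ g₁) (ρ g₂) := by
  have hle : Subgroup.closure {edge n 0, edge n (k n)} ≤
      (Subgroup.zpowers (ρ (edge n 0))).comap ρ := by
    rw [Subgroup.closure_le]
    rintro _ (rfl | rfl)
    · exact Subgroup.mem_zpowers _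
    · exact Subgroup.mem_zpowers_iff.2 ⟨1, by rw [zpow_one, h]⟩
  have hpower (g : (knot n).knotGroup) : ρ g ∈ Subgroup.zpowers (ρ (edge n 0)) :=
    hle (closure_edges n ▸ Subgroup.mem_top g)
  obtain ⟨i, hi⟩ := Subgroup.mem_zpowers_iff.1 (hpower g₁)
  obtain ⟨j, hj⟩ := Subgroup.mem_zpowers_iff.1 (hpower g₂)
  rw [← hi, ← hj]
  exact (Commute.refl _).zpow_zpow i j

theorem isEigenvaluePair_iff {ρ : (knot n).knotGroup →* SL(2, ℂ)} :
    (knot n).IsEigenvaluePair ρ v ↔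
      (pairLongitude n (ρ (edge n 0)) (ρ (edge n (k n)))).1 1 0 = 0 ∧ (ρ (edge n 0)).1 1 0 = 0 ∧
      (pairLongitude n (ρ (edge n 0)) (ρ (edge n (k n)))).1 0 0 = v 0 ∧
      (ρ (edge n 0)).1 0 0 = v 1 := by
  rw [← map_pairLongitude, ← longitude_eq, ← meridian_eq]
  rfl

theorem aeval_curvePoly_of_mem_nonabelian (hv : v ∈ (knot n).nonabelianEigenvaluePairs) :
    aeval v (curvePoly n) = 0 ∨ v 1 ^ 2 = 1 ∧ v 0 ^ 2 = 1 := by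
  obtain ⟨ρ, ⟨g₁, g₂, hne⟩, hρ⟩ := hv
  obtain ⟨hl, ha, hL, hM⟩ := isEigenvaluePair_iff.1 hρ
  have hrel := (edge_knotRelation n).map ρ
  have hac : ρ (edge n (k n)) ≠ ρ (edge n 0) := fun h ↦ hne (commute_of_map_edges_eq ρ h g₁ g₂)
  rw [aeval_curvePoly, ← hL, ← hM]
  by_cases hsq : (ρ (edge n 0)).1 0 0 ^ 2 = 1
  · exact Or.inr ⟨hsq, hrel.sq_upper_left_pairLongitude_eq_one hac ha hsq hl⟩
  · exact Or.inl (hrel.eliminant_eq_zero hac ha hsq hl)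

theorem mem_nonabelian_of_aeval_curvePoly (hA : aeval v (curvePoly n) = 0) (hM : v 1 ≠ 0)
    (hminus : v 1 ^ 2 - 1 ≠ 0) (hplus : v 1 ^ 2 + 1 ≠ 0) (hQ : v 0 * v 1 ^ 2 + 1 ≠ 0) :
    v ∈ (knot n).nonabelianEigenvaluePairs := by
  rw [aeval_curvePoly] at hA
  obtain ⟨y, hq, hr⟩ := exists_riley_eq_zero_of_eliminant_eq_zero hQ hA
  obtain ⟨a, c, hrel, hac, ha, haM, hl, hlL⟩ :=
    exists_pair_of_riley_eq_zero hM hminus hplus hq hr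
  obtain ⟨ρ, rfl, rfl⟩ := hrel.exists_hom
  exact ⟨ρ, ⟨_, _, hac⟩, isEigenvaluePair_iff.2 ⟨hl, ha, hlL, haM⟩⟩

theorem mem_nonabelian_or_eq_one (hv : v ∈ (knot n).eigenvaluePairs) :
    v ∈ (knot n).nonabelianEigenvaluePairs ∨ v 0 = 1 := by
  obtain ⟨ρ, hρ⟩ := hv
  refine or_iff_not_imp_left.2 fun hab ↦ ?_
  have hcomm (g h : (knot n).knotGroup) : ρ g * ρ h = ρ h * ρ g :=
    by_contra fun hne ↦ hab ⟨ρ, ⟨g, h, hne⟩, hρ⟩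
  have hcommutator : (knot n).longitude =
      ⁅(twistR (edge n 0) (edge n (k n)) ^ n)⁻¹, (twistS (edge n 0) (edge n (k n)) ^ 2)⁻¹⁆ := by
    rw [longitude_eq, pairLongitude, commutatorElement_def, inv_inv, inv_inv]
  have hlongitude : ρ (knot n).longitude = 1 := by
    rw [hcommutator, map_commutatorElement, commutatorElement_eq_one_iff_mul_comm, hcomm]
  rw [← hρ.2.2.1, hlongitude, Matrix.SpecialLinearGroup.coe_one, Matrix.one_apply_eq]

theorem mem_eigenvaluePairs_of_eq_one (hL : v 0 = 1) (hM : v 1 ≠ 0) :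
    v ∈ (knot n).eigenvaluePairs := by
  let a : SL(2, ℂ) := ⟨!![v 1, 0; 0, (v 1)⁻¹], by simp [Matrix.det_fin_two_of, hM]⟩
  obtain ⟨ρ, hρ, hρ'⟩ := (KnotRelation.self n a).exists_hom
  refine ⟨ρ, isEigenvaluePair_iff.2 ?_⟩
  rw [hρ, hρ', pairLongitude_self, hL]
  simp [a]

end EigenvaluePairs

section CurvePart

variable {n : ℤ} {F : MvPolynomial (Fin 2) ℂ}

theorem eval_map_curvePoly (n : ℤ) (v : Fin 2 → ℂ) :
    eval v (map (Int.castRingHom ℂ) (curvePoly n)) = eliminant n (v 0) (v 1 ^ 2) := by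
  rw [eval_map_intCast, aeval_curvePoly]

/-- Off the lines `M ^ 2 ∈ {0, 1, -1}` and the curve `L M ^ 2 + 1 = 0`, points of the curve lift to
representations. -/
def exceptionalPoly : MvPolynomial (Fin 2) ℂ :=
  (X 1 ^ 2 - C 0) * (X 1 ^ 2 - C 1) * (X 1 ^ 2 - C (-1)) * (X 0 * X 1 ^ 2 + 1)

theorem not_dvd_exceptionalPoly (hF : Irreducible F)
    (hFA : F ∣ map (Int.castRingHom ℂ) (curvePoly n)) : ¬F ∣ exceptionalPoly := by
  have hline {L m : ℂ} (h : eliminant n L m ≠ 0) : ¬F ∣ X 1 ^ 2 - C m :=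
    not_dvd_X_sq_sub_C hF hFA fun ζ hζ ↦
      ⟨![L, ζ], rfl, by rw [eval_map_curvePoly]; simpa [hζ] using h⟩
  obtain ⟨L, M, hQ, hLM⟩ := exists_eliminant_ne_zero_of_mul_sq_add_one_eq_zero n
  simp only [exceptionalPoly, hF.prime.dvd_mul, not_or]
  exact ⟨⟨⟨hline (eliminant_five_halves_zero_ne_zero n),
    hline (L := 0) (by simp [eliminant_one_right])⟩, hline (eliminant_zero_neg_one_ne_zero n)⟩,
    not_dvd_of_eval_ne_zero hF hFA irreducible_X_mul_X_sq_add_one (v := ![L, M])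
      (by simpa using hQ) (by rw [eval_map_curvePoly]; simpa using hLM)⟩

theorem mem_nonabelian_of_eval_exceptionalPoly {v : Fin 2 → ℂ} (hA : aeval v (curvePoly n) = 0)
    (hv : eval v exceptionalPoly ≠ 0) : v ∈ (knot n).nonabelianEigenvaluePairs := by
  simp only [exceptionalPoly, map_mul, map_sub, map_add, map_pow, map_neg, map_one, map_zero,
    eval_X, sub_zero, sub_neg_eq_add, mul_ne_zero_iff] at hv
  obtain ⟨⟨⟨hM, hminus⟩, hplus⟩, hQ⟩ := hv
  exact mem_nonabelian_of_aeval_curvePoly hA (ne_zero_pow two_ne_zero hM) hminus hplus hQ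

theorem mem_nonabelian_of_eval_factor (hFA : F ∣ map (Int.castRingHom ℂ) (curvePoly n))
    {v : Fin 2 → ℂ} (hF : eval v F = 0) (hv : eval v exceptionalPoly ≠ 0) :
    v ∈ (knot n).nonabelianEigenvaluePairs := by
  refine mem_nonabelian_of_eval_exceptionalPoly ?_ hv
  rw [← eval_map_intCast]
  exact zero_dvd_iff.1 (hF ▸ map_dvd (eval v) hFA)

theorem not_dvd_X_zero_sq_sub_one (hF : Irreducible F) (h : F ∣ X 1 ^ 2 - 1) :
    ¬F ∣ X 0 ^ 2 - 1 := by
  rw [← C_1 (σ := Fin 2)] at h ⊢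
  refine not_dvd_X_sq_sub_C hF h fun ζ _ ↦ ⟨![ζ, 0], rfl, by simp⟩

theorem X_one_sq_sub_one_ne_zero : (X 1 ^ 2 - 1 : MvPolynomial (Fin 2) ℂ) ≠ 0 := fun h ↦ by
  simpa using congrArg (eval ![0, 0]) h

theorem definesCurvePart_nonabelian (n : ℤ) :
    DefinesCurvePart (knot n).nonabelianEigenvaluePairs (curvePoly n) := by
  refine definesCurvePart_of_irreducible_dvd ⟨![0, 1], ?_⟩ X_one_sq_sub_one_ne_zero
    (fun F ↦ not_dvd_X_zero_sq_sub_one) (fun v hv ↦ ?_) fun F hF hFA ↦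
      ⟨exceptionalPoly, not_dvd_exceptionalPoly hF hFA,
        fun v ↦ mem_nonabelian_of_eval_factor hFA⟩
  · rw [aeval_curvePoly]; simp [eliminant_one_right]
  · simpa [sub_eq_zero] using aeval_curvePoly_of_mem_nonabelian hv

theorem definesCurvePart_all (n : ℤ) :
    DefinesCurvePart (knot n).eigenvaluePairs ((X 0 - 1) * curvePoly n) := by
  refine definesCurvePart_of_irreducible_dvd ⟨![0, 1], ?_⟩ X_one_sq_sub_one_ne_zero
    (fun F ↦ not_dvd_X_zero_sq_sub_one) (fun v hv ↦ ?_) fun F hF hFA ↦ ?_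
  · rw [map_mul, aeval_curvePoly]; simp [eliminant_one_right]
  · rcases mem_nonabelian_or_eq_one hv with hv | hL
    · refine (aeval_curvePoly_of_mem_nonabelian hv).imp (fun hA ↦ ?_) fun h ↦ ?_
      · rw [map_mul, hA, mul_zero]
      · simpa [sub_eq_zero] using h
    · left
      simp [hL]
  · rw [map_mul, hF.prime.dvd_mul] at hFA
    rcases hFA with hFL | hFA
    · have hFL : F ∣ X 0 - C 1 := by simpa using hFL
      refine ⟨X 1, not_dvd_of_eval_ne_zero hF hFL ?_ (v := ![0, 0]) ?_ ?_, fun v hv hM ↦ ?_⟩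
      · simpa using irreducible_X_sub_C 1 (0 : ℂ)
      · simp
      · simp
      · have hL : eval v (X 0 - C 1) = 0 := zero_dvd_iff.1 (hv ▸ map_dvd (eval v) hFL)
        exact mem_eigenvaluePairs_of_eq_one (by simpa [sub_eq_zero] using hL) (by simpa using hM)
    · refine ⟨exceptionalPoly, not_dvd_exceptionalPoly hF hFA, fun v hv hH ↦ ?_⟩
      obtain ⟨ρ, -, hρ⟩ := mem_nonabelian_of_eval_factor hFA hv hH
      exact ⟨ρ, hρ⟩

theorem not_dvd_curvePoly {R : Type*} [CommRing R] {P : PolyLM} (v : Fin 2 → R)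
    (hP : aeval v P = 0) (h : eliminant n (v 0) (v 1 ^ 2) ≠ 0) : ¬P ∣ curvePoly n := by
  intro hdvd
  rw [← aeval_curvePoly] at h
  exact h (zero_dvd_iff.1 (hP ▸ map_dvd (aeval v) hdvd))

end CurvePart

end ConwayKnot

end

theorem theorem1p1 (n : ℤ) :
    ∃ A : PolyLM,
      -- `A = p_{2n}(u) p_{2n}(-u)`, whatever the choice of the square roots
      (∀ u r : AlgFun, u ^ 2 = uSquared Lfun Mfun → r ^ 2 = Lfun * Mfun ^ 2 + 1 →
        pFormula n Lfun Mfun r u * pFormula n Lfun Mfun r (-u) = algebraMap PolyLM AlgFun A) ∧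
      -- up to repeated factors, `A` is the A-polynomial of `C(2n, 4)` without its factor `L - 1`
      DefinesCurvePart (ConwayKnot.knot n).nonabelianEigenvaluePairs A ∧
      -- and with the factor `L - 1` of the abelian representations
      DefinesCurvePart (ConwayKnot.knot n).eigenvaluePairs ((MvPolynomial.X 0 - 1) * A) ∧
      -- there are no redundant factors
      ¬ (MvPolynomial.X 0 ∣ A) ∧ ¬ (MvPolynomial.X 1 ∣ A) ∧
      ¬ (MvPolynomial.X 0 * MvPolynomial.X 1 ^ 2 + 1 ∣ A) ∧
      ¬ (MvPolynomial.X 0 - 1 ∣ A) := by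
  refine ⟨ConwayKnot.curvePoly n,
    fun u r ↦ ConwayKnot.pFormula_mul_pFormula_neg_algFun n,
    ConwayKnot.definesCurvePart_nonabelian n, ConwayKnot.definesCurvePart_all n, ?_, ?_, ?_, ?_⟩
  · exact ConwayKnot.not_dvd_curvePoly ![(0 : ℤ), 1] (by simp)
      (by simp [ConwayKnot.eliminant_one_right])
  · exact ConwayKnot.not_dvd_curvePoly ![(5 / 2 : ℂ), 0] (by simp)
      (by simpa using ConwayKnot.eliminant_five_halves_zero_ne_zero n)
  · obtain ⟨L, M, hQ, hLM⟩ := ConwayKnot.exists_eliminant_ne_zero_of_mul_sq_add_one_eq_zero n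
    exact ConwayKnot.not_dvd_curvePoly ![L, M] (by simpa using hQ) (by simpa using hLM)
  · exact ConwayKnot.not_dvd_curvePoly ![(1 : ℤ), 1] (by simp)
      (by simp [ConwayKnot.eliminant_one_right])
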